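/- Let $\mathcal{V}$ be the $\mathbb{Q}$-vector space with basis the set of all Young diagrams, let $\mathcal{V}_n$ be the span of the diagrams with exactly $n$ boxes ($n\ge 0$), and identify $\mathbb{Q}$ with $\mathcal{V}_0$ by writing $1$ for the empty diagram. Define linear operators $\xi,\nabla$ on $\mathcal{V}$ by $$\xi(\lambda)=\sum_{(i,j)}\bigl(\lambda\setminus(i,j)\bigr),\qquad \nabla(\lambda)=\sum_{(i,j)}(j-i)\,\bigl(\lambda\setminus(i,j)\bigr),$$ where both sums run over the boxes $(i,j)$ of $\lambda$ (row $i$, column $j$) whose deletion leaves a Young diagram. A multiplication map is a map $f:\mathcal{V}\times\mathcal{V}\to\mathcal{V}$ such that 1. $f$ is additive in each argument; 2. $f(x,y)\in\mathcal{V}_{n+m}$ for all $n,m\ge 0$, $x\in\mathcal{V}_n$, $y\in\mathcal{V}_m$; 3. $f(a,b)=ab$ for all $a,b\in\mathbb{Q}$; 4. $\xi(f(x,y))=f(\xi(x),y)+f(x,\xi(y))$ for all $x,y\in\mathcal{V}$; 5. $\nabla(f(x,y))=f(\nabla(x),y)+f(x,\nabla(y))$ for all $x,y\in\mathcal{V}$.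 Let $\Lambda$ be the $\mathbb{Q}$-algebra of symmetric functions in countably many variables, i.e. of the formal power series of bounded degree that are invariant under all permutations of the variables, and for a Young diagram $\lambda$ let $s_\lambda\in\Lambda$ be the Schur function, i.e. the generating function of the semistandard Young tableaux of shape $\lambda$ by weight. **Theorem.** There is exactly one multiplication map $*$. It is commutative and associative and has $1$ as unit. For all Young diagrams $\lambda,\mu$ it is given by $$\lambda*\mu=\sum_{\nu}c_{\lambda,\mu}^{\nu}\,\nu,$$ where the $c_{\lambda,\mu}^{\nu}$ are the Littlewood–Richardson coefficients, i.e. the (unique) coefficients of the expansion $s_\lambda s_\mu=\sum_\nu c_{\lambda,\mu}^{\nu}s_\nu$ into a finite linear combination of Schur functions. The resulting ring $\mathbb{Y}=(\mathcal{V},+,*)$ is isomorphic to $\Lambda$; more precisely, the linear map with $\lambda\mapsto s_\lambda$ is an isomorphism of $\mathbb{Q}$-algebras $\mathbb{Y}\to\Lambda$. -/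

import Mathlib

noncomputable section

namespace YoungRing

/-- Formal finite sums of Young diagrams with rational coefficients. -/
abbrev DiagSpan : Type := YoungDiagram →₀ ℚ

/-- A Young diagram, viewed as a basis vector. -/
def diag (μ : YoungDiagram) : DiagSpan := Finsupp.single μ 1

/-- The rational number `a`, viewed as the multiple `a · ∅` of the empty diagram. -/
def const (a : ℚ) : DiagSpan := Finsupp.single ⊥ a

/-- The span of the diagrams with exactly `n` boxes. -/
def homogeneous (n : ℕ) : Submodule ℚ DiagSpan :=
  Finsupp.supported ℚ ℚ {μ : YoungDiagram | μ.card = n}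

open scoped Classical in
/-- The boxes of `μ` whose deletion leaves a Young diagram. -/
def removable (μ : YoungDiagram) : Finset (ℕ × ℕ) :=
  μ.cells.filter fun c => IsLowerSet ((μ.cells.erase c : Finset (ℕ × ℕ)) : Set (ℕ × ℕ))

/-- The diagram `μ` with the removable box `c` deleted. -/
def removeBox (μ : YoungDiagram) (c : ℕ × ℕ) (hc : c ∈ removable μ) : YoungDiagram where
  cells := μ.cells.erase c
  isLowerSet := by
    classical
    exact (Finset.mem_filter.mp hc).2

/-- The linear operator sending `μ` to the sum of all diagrams obtained from `μ` by deleting one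
box `c`, each weighted by `w c`. -/
def boxRemoval (w : ℕ × ℕ → ℚ) : DiagSpan →ₗ[ℚ] DiagSpan :=
  Finsupp.linearCombination ℚ fun μ : YoungDiagram =>
    ∑ c ∈ (removable μ).attach, w c.1 • diag (removeBox μ c.1 c.2)

/-- The operator `ξ`: the sum of all diagrams obtained by deleting one box. -/
def xi : DiagSpan →ₗ[ℚ] DiagSpan := boxRemoval fun _ => 1

/-- The operator `∇`: as `ξ`, but the deleted box (row `i`, column `j`) is weighted by its content
`j - i`. -/
def nabla : DiagSpan →ₗ[ℚ] DiagSpan := boxRemoval fun c => (c.2 : ℚ) - (c.1 : ℚ)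

/-- A multiplication map: distributive, additive on degrees, extending the product of rational
numbers, and satisfying the Leibniz rule for `ξ` and `∇`. -/
structure IsMultiplicationMap (f : DiagSpan → DiagSpan → DiagSpan) : Prop where
  add_left : ∀ x y z, f (x + y) z = f x z + f y z
  add_right : ∀ x y z, f x (y + z) = f x y + f x z
  degree : ∀ (n m : ℕ) (x y : DiagSpan), x ∈ homogeneous n → y ∈ homogeneous m →
    f x y ∈ homogeneous (n + m)
  constants : ∀ a b : ℚ, f (const a) (const b) = const (a * b)
  leibniz_xi : ∀ x y, xi (f x y) = f (xi x) y + f x (xi y)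
  leibniz_nabla : ∀ x y, nabla (f x y) = f (nabla x) y + f x (nabla y)

/-- The ring `Λ` of symmetric functions with rational coefficients in countably many variables:
the formal power series of bounded degree that are invariant under all permutations of the
variables. -/
def symmetricFunctions : Subalgebra ℚ (MvPowerSeries ℕ ℚ) where
  carrier := {p | (∀ e : Equiv.Perm ℕ, MvPowerSeries.rename e p = p) ∧
    ∃ d : ℕ, ∀ m : ℕ →₀ ℕ, d < m.degree → MvPowerSeries.coeff m p = 0}
  add_mem' := by
    rintro p q ⟨hp, d, hd⟩ ⟨hq, d', hd'⟩
    refine ⟨fun e => by rw [map_add, hp, hq], max d d', fun m hm => ?_⟩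
    rw [map_add, hd m (lt_of_le_of_lt (le_max_left _ _) hm),
      hd' m (lt_of_le_of_lt (le_max_right _ _) hm), add_zero]
  mul_mem' := by
    classical
    rintro p q ⟨hp, d, hd⟩ ⟨hq, d', hd'⟩
    refine ⟨fun e => by rw [map_mul, hp, hq], d + d', fun m hm => ?_⟩
    rw [MvPowerSeries.coeff_mul]
    refine Finset.sum_eq_zero fun x hx => ?_
    have hx' : x.1.degree + x.2.degree = m.degree := by
      rw [← map_add, Finset.HasAntidiagonal.mem_antidiagonal.mp hx]
    by_cases h : d < x.1.degree
    · rw [hd _ h, zero_mul]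
    · rw [hd' x.2 (by omega), mul_zero]
  algebraMap_mem' r := by
    classical
    refine ⟨fun e => AlgHom.commutes _ r, 0, fun m hm => ?_⟩
    rw [MvPowerSeries.algebraMap_apply, MvPowerSeries.coeff_C, if_neg]
    rintro rfl
    simp at hm

/-- The weight of a semistandard tableau: the exponent vector counting how often each entry
occurs. -/
def weight {μ : YoungDiagram} (T : SemistandardYoungTableau μ) : ℕ →₀ ℕ :=
  ∑ c ∈ μ.cells, Finsupp.single (T c.1 c.2) 1

/-- The Schur function `s_μ`: the generating function of the semistandard Young tableaux of
shape `μ` by weight. -/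
def schur (μ : YoungDiagram) : MvPowerSeries ℕ ℚ :=
  fun γ => (Nat.card {T : SemistandardYoungTableau μ // weight T = γ} : ℚ)

open scoped Classical in
/-- The Littlewood-Richardson coefficient `c_{λ,μ}^ν`: the coefficient of `s_ν` in the unique
expansion of `s_λ s_μ` as a finite linear combination of Schur functions. -/
def littlewoodRichardson (l m n : YoungDiagram) : ℚ :=
  if h : ∃! c : YoungDiagram →₀ ℚ,
      Finsupp.linearCombination ℚ schur c = schur l * schur m
  then h.choose n else 0

end YoungRing

end

/-!
The product is the product of symmetric functions, transported along `λ ↦ s_λ`. Write `K(λ, γ)` for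
the Kostka number, the coefficient of `x^γ` in `s_λ`, and `ν ≺ λ` if the row lengths of `ν` and `λ`
interlace, i.e. if `λ / ν` is a horizontal strip. All facts about Schur functions come from the
branching rule `kostka_add_single`: in a tableau with largest entry `N`, the boxes with entry `N`
form a horizontal strip, and the other boxes form an arbitrary smaller tableau.

*Uniqueness.* The difference of two multiplication maps satisfies both Leibniz rules, so by
induction on the total degree it takes values killed by `ξ` and `∇`. A homogeneous element of
positive degree killed by both operators vanishes (`eq_zero_of_xi_nabla`).

*Symmetry.* Branching twice, the `μ` with `ν ≺ μ ≺ λ` are described by independent conditions on the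
row lengths of `μ`, each confining one of them to an interval. Reflecting all these intervals
exchanges the numbers of boxes of the two strips (`exists_reflection`), so `s_λ` is invariant under
adjacent transpositions of the variables, hence under all permutations.

*Basis.* The sum of the entries of a tableau is determined by its weight, and each entry is at
least its row index. Hence the Kostka matrix is triangular with respect to `∑ i` over the boxes
`(i, j)` (`eq_of_kostka_rowWeight_ne_zero`). In each bounded degree it is a finite square matrix, so
the Schur functions span `Λ` as well.

*Leibniz rules.* On coefficients of monomials in the variables `x_0, …, x_{N-1}`, the derivative
`∂_N` of `s_λ` is the sum of the `s_{λ ∖ c}` over the removable boxes `c`, and `∑_{i < N} ∂_i s_λ`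
is the sum of the `(N + content c) s_{λ ∖ c}` (`sum_kostka_add_single`). So `ξ` and `∇` correspond
to the derivations `∂_N` and `∑_{i < N} ∂_i - N ∂_N`, restricted to such monomials, for every `N`.
The formula for `∑_{i < N} ∂_i` follows by induction on `N` from the branching rule and the identity
`strip_identity`, which compares content-weighted counts of the horizontal strips that arise from a
pair `ν`, `λ` by adding a box to `ν` and by removing a box from `λ`.
-/

noncomputable section

namespace YoungRing

open scoped Classical

/-! ### Young diagrams described by their row lengths -/

theorem diagram_ext {μ ν : YoungDiagram} (h : ∀ i, μ.rowLen i = ν.rowLen i) : μ = ν := by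
  apply SetLike.ext
  rintro ⟨i, j⟩
  rw [YoungDiagram.mem_iff_lt_rowLen, YoungDiagram.mem_iff_lt_rowLen, h]

theorem le_iff_rowLen_le {μ ν : YoungDiagram} : μ ≤ ν ↔ ∀ i, μ.rowLen i ≤ ν.rowLen i := by
  constructor
  · intro h i
    by_contra! hlt
    have : (i, ν.rowLen i) ∈ ν := h (YoungDiagram.mem_iff_lt_rowLen.mpr hlt)
    exact absurd (YoungDiagram.mem_iff_lt_rowLen.mp this) (lt_irrefl _)
  · rintro h ⟨i, j⟩ hc
    exact YoungDiagram.mem_iff_lt_rowLen.mpr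
      ((YoungDiagram.mem_iff_lt_rowLen.mp hc).trans_le (h i))

theorem exists_rowLen_eq (r : ℕ → ℕ) (hr : Antitone r) (M : ℕ) (hM : r M = 0) :
    ∃ μ : YoungDiagram, ∀ i, μ.rowLen i = r i := by
  let μ : YoungDiagram :=
    { cells := (Finset.range M ×ˢ Finset.range (r 0)).filter fun c => c.2 < r c.1
      isLowerSet := by
        rintro ⟨i, j⟩ ⟨i', j'⟩ ⟨hi, hj⟩ h
        simp only [Finset.coe_filter, Finset.mem_product, Finset.mem_range, Set.mem_ofPred_eq]
          at h hi hj ⊢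
        have := hr hi
        omega }
  refine ⟨μ, fun i => ?_⟩
  have key : ∀ j, j < μ.rowLen i ↔ j < r i := by
    intro j
    rw [← YoungDiagram.mem_iff_lt_rowLen, ← YoungDiagram.mem_cells]
    simp only [μ, Finset.mem_filter, Finset.mem_product, Finset.mem_range]
    constructor
    · exact fun h => h.2
    · intro h
      have h0 := hr (Nat.zero_le i)
      have : i < M := by
        by_contra! hc
        have := hr hc
        omega
      omega
  have h1 := key (r i)
  have h2 := key (μ.rowLen i)
  omega

theorem rowLen_colLen_zero (μ : YoungDiagram) : μ.rowLen (μ.colLen 0) = 0 := by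
  by_contra h
  have : (μ.colLen 0, 0) ∈ μ := YoungDiagram.mem_iff_lt_rowLen.mpr (Nat.pos_of_ne_zero h)
  exact absurd (YoungDiagram.mem_iff_lt_colLen.mp this) (lt_irrefl _)

theorem rowLen_eq_zero_of_le {μ : YoungDiagram} {M i : ℕ} (hM : μ.rowLen M = 0) (h : M ≤ i) :
    μ.rowLen i = 0 :=
  Nat.eq_zero_of_le_zero (hM ▸ μ.rowLen_anti _ _ h)

theorem sum_cells {A : Type*} [AddCommMonoid A] (μ : YoungDiagram) {M : ℕ} (hM : μ.rowLen M = 0)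
    (g : ℕ × ℕ → A) :
    ∑ c ∈ μ.cells, g c = ∑ i ∈ Finset.range M, ∑ j ∈ Finset.range (μ.rowLen i), g (i, j) := by
  refine Finset.sum_finset_product _ _ _ ?_
  rintro ⟨i, j⟩
  rw [YoungDiagram.mem_cells, YoungDiagram.mem_iff_lt_rowLen]
  simp only [Finset.mem_range]
  refine ⟨fun h => ⟨?_, h⟩, fun h => h.2⟩
  by_contra! hc
  have := rowLen_eq_zero_of_le hM hc
  omega

theorem card_eq_sum_rowLen (μ : YoungDiagram) {M : ℕ} (hM : μ.rowLen M = 0) :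
    μ.card = ∑ i ∈ Finset.range M, μ.rowLen i := by
  rw [YoungDiagram.card, Finset.card_eq_sum_ones, sum_cells μ hM]
  simp

theorem eq_bot_of_card_eq_zero {μ : YoungDiagram} (h : μ.card = 0) : μ = ⊥ := by
  apply YoungDiagram.ext
  rw [YoungDiagram.cells_bot]
  exact Finset.card_eq_zero.mp h

theorem finite_le (μ : YoungDiagram) : {ν : YoungDiagram | ν ≤ μ}.Finite := by
  refine Set.Finite.of_injOn (f := YoungDiagram.cells) (t := (μ.cells.powerset : Set _)) ?_ ?_
    (Finset.finite_toSet _)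
  · intro ν hν
    simpa using YoungDiagram.cells_subset_iff.mpr hν
  · intro ν _ ν' _ h
    exact YoungDiagram.ext h

/-- The diagrams contained in `μ`. -/
def below (μ : YoungDiagram) : Finset YoungDiagram := (finite_le μ).toFinset

@[simp]
theorem mem_below {μ ν : YoungDiagram} : ν ∈ below μ ↔ ν ≤ μ := by
  simp [below]

/-- `HorizontalStrip ν μ`: the rows of `ν` and `μ` interlace, that is `ν ⊆ μ` and `μ / ν` has
at most one box in each column. -/
def HorizontalStrip (ν μ : YoungDiagram) : Prop :=
  ∀ k, μ.rowLen (k + 1) ≤ ν.rowLen k ∧ ν.rowLen k ≤ μ.rowLen k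

/-- `AddsBox ν i μ`: the diagram `μ` is `ν` with one box added at the end of row `i`. -/
def AddsBox (ν : YoungDiagram) (i : ℕ) (μ : YoungDiagram) : Prop :=
  ∀ k, μ.rowLen k = ν.rowLen k + if k = i then 1 else 0

theorem HorizontalStrip.le {ν μ : YoungDiagram} (h : HorizontalStrip ν μ) : ν ≤ μ :=
  le_iff_rowLen_le.mpr fun k => (h k).2

theorem AddsBox.le {ν μ : YoungDiagram} {i : ℕ} (h : AddsBox ν i μ) : ν ≤ μ :=
  le_iff_rowLen_le.mpr fun k => by rw [h k]; exact Nat.le_add_right _ _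

theorem AddsBox.pos {ν μ : YoungDiagram} {i : ℕ} (h : AddsBox ν i μ) : 0 < μ.rowLen i := by
  rw [h i, if_pos rfl]; exact Nat.succ_pos _

theorem AddsBox.unique_left {ν ν' μ : YoungDiagram} {i : ℕ} (h : AddsBox ν i μ)
    (h' : AddsBox ν' i μ) : ν = ν' :=
  diagram_ext fun k => by have := h k; have := h' k; omega

theorem AddsBox.unique_right {ν μ μ' : YoungDiagram} {i : ℕ} (h : AddsBox ν i μ)
    (h' : AddsBox ν i μ') : μ = μ' :=
  diagram_ext fun k => by rw [h k, h' k]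

theorem AddsBox.cells_eq {ν μ : YoungDiagram} {i : ℕ} (h : AddsBox ν i μ) :
    μ.cells = insert (i, ν.rowLen i) ν.cells := by
  ext ⟨a, b⟩
  rw [Finset.mem_insert, YoungDiagram.mem_cells, YoungDiagram.mem_cells,
    YoungDiagram.mem_iff_lt_rowLen, YoungDiagram.mem_iff_lt_rowLen, h a, Prod.mk.injEq]
  by_cases hai : a = i
  · subst hai; simp; omega
  · simp [hai]

theorem rowEnd_notMem_cells {ν : YoungDiagram} {i : ℕ} : (i, ν.rowLen i) ∉ ν.cells := by
  rw [YoungDiagram.mem_cells, YoungDiagram.mem_iff_lt_rowLen]; exact lt_irrefl _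

theorem AddsBox.card {ν μ : YoungDiagram} {i : ℕ} (h : AddsBox ν i μ) : μ.card = ν.card + 1 := by
  rw [YoungDiagram.card, h.cells_eq, Finset.card_insert_of_notMem rowEnd_notMem_cells]

theorem AddsBox.horizontalStrip {ν μ : YoungDiagram} {i : ℕ} (h : AddsBox ν i μ) :
    HorizontalStrip ν μ := by
  intro k
  have h1 := h k
  have h2 := h (k + 1)
  have h3 := ν.rowLen_anti k (k + 1) (Nat.le_succ k)
  have h4 := μ.rowLen_anti k (k + 1) (Nat.le_succ k)
  split_ifs at h1 h2 <;> omega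

/-! ### Removing boxes -/

theorem mem_removable {μ : YoungDiagram} {c : ℕ × ℕ} (hc : c ∈ removable μ) : c ∈ μ :=
  (YoungDiagram.mem_cells c).mp (Finset.mem_filter.mp hc).1

theorem addsBox_removeBox {μ : YoungDiagram} {c : ℕ × ℕ} (hc : c ∈ removable μ) :
    AddsBox (removeBox μ c hc) c.1 μ ∧ (removeBox μ c hc).rowLen c.1 = c.2 := by
  obtain ⟨a, b⟩ := c
  set ν := removeBox μ (a, b) hc with hν
  have hmem : ∀ i j, j < ν.rowLen i ↔ (i, j) ≠ (a, b) ∧ j < μ.rowLen i := by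
    intro i j
    rw [← YoungDiagram.mem_iff_lt_rowLen, ← YoungDiagram.mem_iff_lt_rowLen,
      ← YoungDiagram.mem_cells, ← YoungDiagram.mem_cells, hν, removeBox]
    exact Finset.mem_erase
  have hab : b < μ.rowLen a := YoungDiagram.mem_iff_lt_rowLen.mp (mem_removable hc)
  have h1 := hmem a b
  simp only [ne_eq, not_true_eq_false, false_and, iff_false] at h1
  have h2 := hmem a (μ.rowLen a - 1)
  have h3 := hmem a (ν.rowLen a)
  have h4 := hmem a (b - 1)
  simp only [ne_eq, Prod.mk.injEq, true_and] at h2 h3 h4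
  refine ⟨fun k => ?_, ?_⟩
  · by_cases hk : k = a
    · subst hk; rw [if_pos rfl]; omega
    · have h5 := hmem k (μ.rowLen k)
      have h6 := hmem k (ν.rowLen k)
      simp only [ne_eq, Prod.mk.injEq, hk, false_and, not_false_eq_true, true_and] at h5 h6
      rw [if_neg hk]; omega
  · show ν.rowLen a = b
    omega

theorem AddsBox.mem_removable {ν μ : YoungDiagram} {i : ℕ} (h : AddsBox ν i μ) :
    ∃ hc : (i, ν.rowLen i) ∈ removable μ, removeBox μ _ hc = ν := by
  have he : μ.cells.erase (i, ν.rowLen i) = ν.cells := by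
    rw [h.cells_eq, Finset.erase_insert rowEnd_notMem_cells]
  have hc : (i, ν.rowLen i) ∈ removable μ := by
    refine Finset.mem_filter.mpr ⟨?_, ?_⟩
    · rw [h.cells_eq]; exact Finset.mem_insert_self _ _
    · convert ν.isLowerSet
  refine ⟨hc, YoungDiagram.ext ?_⟩
  rw [← he, removeBox]

/-- A sum over removable boxes as a sum over smaller diagrams and row indices, with index sets
independent of `μ`, so that it can be interchanged with other sums. -/
theorem sum_removable (w : ℕ × ℕ → ℚ) (F : YoungDiagram → ℚ) (μ : YoungDiagram)
    (B : Finset YoungDiagram) (hB : ∀ ν i, AddsBox ν i μ → ν ∈ B) (M : ℕ) (hM : μ.rowLen M = 0) :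
    ∑ c ∈ (removable μ).attach, w c.1 * F (removeBox μ c.1 c.2) =
      ∑ ν ∈ B, ∑ i ∈ Finset.range M, if AddsBox ν i μ then w (i, ν.rowLen i) * F ν else 0 := by
  rw [← Finset.sum_product' (f := fun ν i =>
    if AddsBox ν i μ then w (i, ν.rowLen i) * F ν else 0), ← Finset.sum_filter]
  refine Finset.sum_bij (fun c _ => (removeBox μ c.1 c.2, c.1.1)) ?_ ?_ ?_ ?_
  · rintro ⟨c, hc⟩ -
    have h := (addsBox_removeBox hc).1
    simp only [Finset.mem_filter, Finset.mem_product, Finset.mem_range]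
    refine ⟨⟨hB _ _ h, ?_⟩, h⟩
    by_contra! hle
    have := rowLen_eq_zero_of_le hM hle
    have := h.pos
    omega
  · rintro ⟨c, hc⟩ - ⟨c', hc'⟩ - h
    simp only [Prod.mk.injEq] at h
    apply Subtype.ext
    refine Prod.ext h.2 ?_
    show c.2 = c'.2
    rw [← (addsBox_removeBox hc).2, ← (addsBox_removeBox hc').2, h.1, h.2]
  · rintro ⟨ν, i⟩ h
    simp only [Finset.mem_filter] at h
    obtain ⟨hc, he⟩ := h.2.mem_removable
    exact ⟨⟨_, hc⟩, Finset.mem_attach _ _, by simp [he]⟩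
  · rintro ⟨c, hc⟩ -
    have h := (addsBox_removeBox hc)
    simp only [h.2]

theorem boxRemoval_diag (w : ℕ × ℕ → ℚ) (μ : YoungDiagram) :
    boxRemoval w (diag μ) = ∑ c ∈ (removable μ).attach, w c.1 • diag (removeBox μ c.1 c.2) := by
  rw [boxRemoval, diag, Finsupp.linearCombination_single, one_smul]

/-- The statistic `∑ i` over the boxes `(i, j)` of `μ`. -/
def rowStat (μ : YoungDiagram) : ℕ := ∑ c ∈ μ.cells, c.1

theorem AddsBox.rowStat {ν μ : YoungDiagram} {i : ℕ} (h : AddsBox ν i μ) :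
    rowStat μ = rowStat ν + i := by
  rw [YoungRing.rowStat, h.cells_eq, Finset.sum_insert rowEnd_notMem_cells, YoungRing.rowStat,
    add_comm]

/-! ### The common kernel of the two operators and uniqueness -/

theorem boxRemoval_apply (w : ℕ × ℕ → ℚ) (x : DiagSpan) (μ : YoungDiagram) :
    boxRemoval w x μ = ∑ l ∈ x.support, x l * boxRemoval w (diag l) μ := by
  conv_lhs => rw [boxRemoval, Finsupp.linearCombination_apply, Finsupp.sum, Finsupp.finsetSum_apply]
  refine Finset.sum_congr rfl fun l _ => ?_
  rw [boxRemoval_diag, Finsupp.smul_apply, smul_eq_mul]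

theorem boxRemoval_diag_apply (w : ℕ × ℕ → ℚ) (l μ : YoungDiagram) :
    boxRemoval w (diag l) μ = ∑ c ∈ (removable l).attach,
      w c.1 * if removeBox l c.1 c.2 = μ then 1 else 0 := by
  rw [boxRemoval_diag, Finsupp.finsetSum_apply]
  refine Finset.sum_congr rfl fun c _ => ?_
  rw [Finsupp.smul_apply, smul_eq_mul, diag, Finsupp.single_apply]

theorem boxRemoval_diag_apply_eq_zero (w : ℕ × ℕ → ℚ) (l μ : YoungDiagram)
    (h : ∀ i, AddsBox μ i l → w (i, μ.rowLen i) = 0) : boxRemoval w (diag l) μ = 0 := by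
  rw [boxRemoval_diag_apply]
  refine Finset.sum_eq_zero fun c _ => ?_
  obtain ⟨h1, h2⟩ := addsBox_removeBox c.2
  split_ifs with he
  · rw [he] at h1 h2
    have := h _ h1
    rw [h2] at this
    rw [mul_one]
    exact this
  · rw [mul_zero]

theorem boxRemoval_diag_apply_of_addsBox (w : ℕ × ℕ → ℚ) {l μ : YoungDiagram} {i : ℕ}
    (h : AddsBox μ i l) : boxRemoval w (diag l) μ = w (i, μ.rowLen i) := by
  rw [boxRemoval_diag_apply]
  obtain ⟨hc, he⟩ := h.mem_removable
  rw [Finset.sum_eq_single (⟨_, hc⟩ : {c // c ∈ removable l})]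
  · rw [if_pos he, mul_one]
  · rintro ⟨c, hc'⟩ - hne
    rw [if_neg, mul_zero]
    rintro rfl
    apply hne
    obtain ⟨h1, h2⟩ := addsBox_removeBox hc'
    have hi : c.1 = i := by
      have e1 := h1 c.1
      have e2 := h c.1
      dsimp only at e2
      by_contra hne
      rw [if_pos rfl] at e1
      rw [if_neg hne] at e2
      omega
    apply Subtype.ext
    subst hi
    exact Prod.ext rfl h2.symm
  · intro hn; exact absurd (Finset.mem_attach _ _) hn

/-- Every nonempty diagram has a removable box at the end of its last row. -/
theorem exists_addsBox_lastRow {l : YoungDiagram} (h : l ≠ ⊥) :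
    ∃ μ r, AddsBox μ r l ∧ ∀ k, r < k → l.rowLen k = 0 := by
  have hpos : 0 < l.colLen 0 := by
    by_contra! hc
    apply h
    apply diagram_ext
    intro i
    have h1 := rowLen_colLen_zero l
    rw [rowLen_eq_zero_of_le h1 (by omega)]
    by_contra hne
    exact YoungDiagram.notMem_bot _ (YoungDiagram.mem_iff_lt_rowLen.mpr
      (Nat.pos_of_ne_zero (Ne.symm hne)))
  obtain ⟨r, hr⟩ : ∃ r, l.colLen 0 = r + 1 := ⟨_, (Nat.succ_pred_eq_of_pos hpos).symm⟩
  have hz : ∀ k, r < k → l.rowLen k = 0 := fun k hk =>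
    rowLen_eq_zero_of_le (rowLen_colLen_zero l) (by omega)
  have hrpos : 0 < l.rowLen r := by
    rw [← YoungDiagram.mem_iff_lt_rowLen, YoungDiagram.mem_iff_lt_colLen]; omega
  obtain ⟨μ, hμ⟩ := exists_rowLen_eq (fun k => l.rowLen k - if k = r then 1 else 0)
    (by
      intro a b hab
      have h1 := l.rowLen_anti a b hab
      rcases Nat.lt_or_ge r b with hb | hb
      · have := hz b hb; simp only []; omega
      · dsimp only; split_ifs <;> omega) (r + 1) (by simp [hz])
  refine ⟨μ, r, fun k => ?_, hz⟩
  rw [hμ k]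
  split_ifs with hk
  · subst hk; omega
  · omega

/-- A homogeneous element of positive degree killed by both operators vanishes. Among the diagrams
occurring in it, one whose statistic `rowStat` is minimal, with last row `r`, is the only one that
contributes to the coefficient of the diagram without its last box under `∇ + (r + 1) ξ`: the
constant is chosen such that a new row `r + 1` gets weight `0`. -/
theorem eq_zero_of_xi_nabla {n : ℕ} (hn : n ≠ 0) {x : DiagSpan} (hx : x ∈ homogeneous n)
    (h1 : xi x = 0) (h2 : nabla x = 0) : x = 0 := by
  by_contra hne
  obtain ⟨l, hl, hmin⟩ := Finset.exists_min_image x.support rowStat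
    (Finsupp.support_nonempty_iff.mpr hne)
  have hcard : l.card = n := (Finsupp.mem_supported _ _).mp hx hl
  have hbot : l ≠ ⊥ := by
    rintro rfl
    apply hn
    rw [← hcard]
    simp [YoungDiagram.card]
  obtain ⟨μ, r, hμ, hz⟩ := exists_addsBox_lastRow hbot
  -- `w` is the content, shifted such that the box `(r + 1, 0)` has weight `0`
  set w : ℕ × ℕ → ℚ := fun c => (c.2 : ℚ) - c.1 + (r + 1) with hw
  have hlin : ∀ y, boxRemoval w y = nabla y + ((r : ℚ) + 1) • xi y := by
    intro y
    induction y using Finsupp.induction_linear with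
    | zero => simp
    | add y z hy hz => rw [map_add, map_add, map_add, hy, hz, smul_add]; abel
    | single l a =>
      have : (Finsupp.single l a : DiagSpan) = a • diag l := by
        rw [diag, Finsupp.smul_single, smul_eq_mul, mul_one]
      rw [this, map_smul, map_smul, map_smul, smul_comm, ← smul_add]
      congr 1
      rw [nabla, xi, boxRemoval_diag, boxRemoval_diag, boxRemoval_diag, Finset.smul_sum,
        ← Finset.sum_add_distrib]
      refine Finset.sum_congr rfl fun c _ => ?_
      rw [smul_smul, ← add_smul, mul_one]
  have h0 : boxRemoval w x μ = 0 := by rw [hlin, h1, h2, smul_zero, add_zero]; rfl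
  rw [boxRemoval_apply, Finset.sum_eq_single l] at h0
  · rw [boxRemoval_diag_apply_of_addsBox w hμ] at h0
    have hxl := Finsupp.mem_support_iff.mp hl
    have := (mul_eq_zero.mp h0).resolve_left hxl
    simp only [hw] at this
    have h3 : (0 : ℚ) ≤ (μ.rowLen r : ℚ) := Nat.cast_nonneg _
    linarith
  · intro l' hl' hne'
    rw [boxRemoval_diag_apply_eq_zero, mul_zero]
    intro i hi
    have hle := hmin l' hl'
    rw [hi.rowStat, hμ.rowStat] at hle
    have hir : i ≠ r := by rintro rfl; exact hne' (hi.unique_right hμ)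
    have hir1 : i = r + 1 := by
      by_contra hc
      have e1 := hi i
      have e2 := hi (r + 1)
      have e3 := l'.rowLen_anti (r + 1) i (by omega)
      have e4 := hμ (r + 1)
      have e5 := hz (r + 1) (by omega)
      rw [if_pos rfl] at e1
      rw [if_neg (by omega)] at e2
      omega
    subst hir1
    have e4 := hμ (r + 1)
    rw [hz (r + 1) (by omega)] at e4
    have : μ.rowLen (r + 1) = 0 := by omega
    simp [hw, this]
  · intro hn; exact absurd hl hn

theorem boxRemoval_mem_homogeneous (w : ℕ × ℕ → ℚ) {n : ℕ} {l : YoungDiagram}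
    (hl : l.card = n + 1) (a : ℚ) :
    boxRemoval w (Finsupp.single l a) ∈ homogeneous n := by
  have : (Finsupp.single l a : DiagSpan) = a • diag l := by
    rw [diag, Finsupp.smul_single, smul_eq_mul, mul_one]
  rw [this, map_smul, boxRemoval_diag]
  refine Submodule.smul_mem _ _ (Submodule.sum_mem _ fun c _ => Submodule.smul_mem _ _ ?_)
  refine Finsupp.single_mem_supported _ _ ?_
  have := (addsBox_removeBox c.2).1.card
  show YoungDiagram.card _ = n
  omega

theorem boxRemoval_const (w : ℕ × ℕ → ℚ) (a : ℚ) : boxRemoval w (const a) = 0 := by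
  have : const a = a • diag ⊥ := by
    rw [const, diag, Finsupp.smul_single, smul_eq_mul, mul_one]
  rw [this, map_smul, boxRemoval_diag, Finset.sum_eq_zero, smul_zero]
  rintro ⟨c, hc⟩ -
  exact absurd (mem_removable hc) (YoungDiagram.notMem_bot c)

theorem single_mem_homogeneous {l : YoungDiagram} {n : ℕ} (h : l.card = n) (a : ℚ) :
    (Finsupp.single l a : DiagSpan) ∈ homogeneous n :=
  Finsupp.single_mem_supported _ _ h

theorem IsMultiplicationMap.zero_left {f : DiagSpan → DiagSpan → DiagSpan}
    (hf : IsMultiplicationMap f) (y : DiagSpan) : f 0 y = 0 := by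
  have := hf.add_left 0 0 y
  rwa [add_zero, left_eq_add] at this

theorem IsMultiplicationMap.zero_right {f : DiagSpan → DiagSpan → DiagSpan}
    (hf : IsMultiplicationMap f) (x : DiagSpan) : f x 0 = 0 := by
  have := hf.add_right x 0 0
  rwa [add_zero, left_eq_add] at this

/-- By additivity, multiplication maps may be compared on multiples of the diagrams that occur in
the arguments. -/
theorem eq_of_eq_on_single {f g : DiagSpan → DiagSpan → DiagSpan}
    (hf : IsMultiplicationMap f) (hg : IsMultiplicationMap g) {S T : Set YoungDiagram}
    (h : ∀ l ∈ S, ∀ m ∈ T, ∀ a b, f (Finsupp.single l a) (Finsupp.single m b) =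
      g (Finsupp.single l a) (Finsupp.single m b))
    {x y : DiagSpan} (hx : x ∈ Finsupp.supported ℚ ℚ S) (hy : y ∈ Finsupp.supported ℚ ℚ T) :
    f x y = g x y := by
  induction x using Finsupp.induction with
  | zero => rw [hf.zero_left, hg.zero_left]
  | single_add l a x hl ha ih =>
    rw [Finsupp.mem_supported, Finsupp.support_single_add hl ha, Finset.coe_cons,
      Set.insert_subset_iff] at hx
    rw [hf.add_left, hg.add_left, ih ((Finsupp.mem_supported _ _).mpr hx.2)]
    congr 1
    clear ih
    induction y using Finsupp.induction with
    | zero => rw [hf.zero_right, hg.zero_right]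
    | single_add m b y hm hb ih =>
      rw [Finsupp.mem_supported, Finsupp.support_single_add hm hb, Finset.coe_cons,
        Set.insert_subset_iff] at hy
      rw [hf.add_right, hg.add_right, ih ((Finsupp.mem_supported _ _).mpr hy.2),
        h l hx.1 m hy.1]

theorem IsMultiplicationMap.unique {f g : DiagSpan → DiagSpan → DiagSpan}
    (hf : IsMultiplicationMap f) (hg : IsMultiplicationMap g) : f = g := by
  have key : ∀ k : ℕ, ∀ l m : YoungDiagram, l.card + m.card = k → ∀ a b,
      f (Finsupp.single l a) (Finsupp.single m b) =
        g (Finsupp.single l a) (Finsupp.single m b) := by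
    intro k
    induction k with
    | zero =>
      intro l m h a b
      rw [eq_bot_of_card_eq_zero (by omega : l.card = 0),
        eq_bot_of_card_eq_zero (by omega : m.card = 0)]
      exact (hf.constants a b).trans (hg.constants a b).symm
    | succ k ih =>
      intro l m h a b
      have hleft : ∀ w, f (boxRemoval w (Finsupp.single l a)) (Finsupp.single m b) =
          g (boxRemoval w (Finsupp.single l a)) (Finsupp.single m b) := by
        intro w
        rcases Nat.eq_zero_or_eq_succ_pred l.card with h0 | h0
        · rw [eq_bot_of_card_eq_zero h0, show (Finsupp.single ⊥ _ : DiagSpan) = const _ from rfl,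
            boxRemoval_const, hf.zero_left, hg.zero_left]
        · refine eq_of_eq_on_single hf hg ?_ (boxRemoval_mem_homogeneous w h0 a)
            (single_mem_homogeneous rfl b)
          intro l' hl' m' hm' a' b'
          have e1 : l'.card = l.card.pred := hl'
          have e2 : m'.card = m.card := hm'
          exact ih l' m' (by omega) a' b'
      have hright : ∀ w, f (Finsupp.single l a) (boxRemoval w (Finsupp.single m b)) =
          g (Finsupp.single l a) (boxRemoval w (Finsupp.single m b)) := by
        intro w
        rcases Nat.eq_zero_or_eq_succ_pred m.card with h0 | h0
        · rw [eq_bot_of_card_eq_zero h0, show (Finsupp.single ⊥ _ : DiagSpan) = const _ from rfl,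
            boxRemoval_const, hf.zero_right, hg.zero_right]
        · refine eq_of_eq_on_single hf hg ?_ (single_mem_homogeneous rfl a)
            (boxRemoval_mem_homogeneous w h0 b)
          intro l' hl' m' hm' a' b'
          have e1 : l'.card = l.card := hl'
          have e2 : m'.card = m.card.pred := hm'
          exact ih l' m' (by omega) a' b'
      refine sub_eq_zero.mp (eq_zero_of_xi_nabla (Nat.succ_ne_zero k) ?_ ?_ ?_)
      · rw [Nat.succ_eq_add_one, ← h]
        exact Submodule.sub_mem _
          (hf.degree _ _ _ _ (single_mem_homogeneous rfl a) (single_mem_homogeneous rfl b))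
          (hg.degree _ _ _ _ (single_mem_homogeneous rfl a) (single_mem_homogeneous rfl b))
      · rw [map_sub, hf.leibniz_xi, hg.leibniz_xi, xi, hleft, hright, sub_self]
      · rw [map_sub, hf.leibniz_nabla, hg.leibniz_nabla, nabla, hleft, hright, sub_self]
  funext x y
  refine eq_of_eq_on_single hf hg (S := Set.univ) (T := Set.univ)
    (fun l _ m _ a b => key _ l m rfl a b) ?_ ?_ <;> simp [Finsupp.supported_univ]

/-! ### Counting tableaux by weight: the branching rule -/

/-- The Kostka number: the number of semistandard tableaux of shape `l` and weight `γ`. -/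
def kostka (l : YoungDiagram) (γ : ℕ →₀ ℕ) : ℕ :=
  Nat.card {T : SemistandardYoungTableau l // weight T = γ}

theorem coeff_schur (l : YoungDiagram) (γ : ℕ →₀ ℕ) :
    MvPowerSeries.coeff γ (schur l) = kostka l γ := rfl

theorem weight_apply {l : YoungDiagram} (T : SemistandardYoungTableau l) (k : ℕ) :
    weight T k = (l.cells.filter fun c => T c.1 c.2 = k).card := by
  rw [weight, Finsupp.finsetSum_apply, Finset.card_filter]
  exact Finset.sum_congr rfl fun c _ => Finsupp.single_apply

theorem degree_weight {l : YoungDiagram} (T : SemistandardYoungTableau l) :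
    (weight T).degree = l.card := by
  rw [weight, map_sum]
  simp [YoungDiagram.card]

theorem weight_entry_ne_zero {l : YoungDiagram} (T : SemistandardYoungTableau l) {i j : ℕ}
    (h : (i, j) ∈ l) : weight T (T i j) ≠ 0 := by
  rw [weight_apply]
  exact Finset.card_ne_zero_of_mem (a := (i, j)) (Finset.mem_filter.mpr ⟨h, rfl⟩)

instance finite_tableaux (l : YoungDiagram) (γ : ℕ →₀ ℕ) :
    Finite {T : SemistandardYoungTableau l // weight T = γ} := by
  refine Finite.of_injective
    (fun T => fun c : l.cells => (⟨T.1 c.1.1 c.1.2, ?_⟩ : γ.support)) ?_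
  · exact Finsupp.mem_support_iff.mpr
      (DFunLike.congr_fun T.2 (T.1 c.1.1 c.1.2) ▸ weight_entry_ne_zero T.1 c.2)
  · rintro ⟨T, hT⟩ ⟨T', hT'⟩ h
    apply Subtype.ext
    apply SemistandardYoungTableau.ext
    intro i j
    by_cases hc : (i, j) ∈ l
    · have := congrFun h ⟨(i, j), hc⟩
      simpa using this
    · rw [T.zeros hc, T'.zeros hc]

theorem kostka_eq_zero_of_degree {l : YoungDiagram} {γ : ℕ →₀ ℕ} (h : γ.degree ≠ l.card) :
    kostka l γ = 0 := by
  have : IsEmpty {T : SemistandardYoungTableau l // weight T = γ} :=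
    ⟨fun T => h (by rw [← T.2, degree_weight])⟩
  exact Nat.card_of_isEmpty

theorem kostka_bot_zero : kostka ⊥ 0 = 1 := by
  have : Unique {T : SemistandardYoungTableau ⊥ // weight T = 0} :=
    { default := ⟨default, by simp [weight]⟩
      uniq := by
        rintro ⟨T, hT⟩
        apply Subtype.ext
        apply SemistandardYoungTableau.ext
        intro i j
        rw [T.zeros (YoungDiagram.notMem_bot _), SemistandardYoungTableau.zeros _
          (YoungDiagram.notMem_bot _)] }
  exact Nat.card_unique

theorem schur_bot : schur ⊥ = 1 := by
  ext γ
  rw [coeff_schur, MvPowerSeries.coeff_one]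
  split_ifs with h
  · rw [h, kostka_bot_zero, Nat.cast_one]
  · rw [kostka_eq_zero_of_degree, Nat.cast_zero]
    rw [YoungDiagram.card, YoungDiagram.cells_bot, Finset.card_empty]
    exact fun h0 => h ((Finsupp.degree_eq_zero_iff γ).mp h0)

theorem HorizontalStrip.mem_of_lt {μ l : YoungDiagram} (h : HorizontalStrip μ l) {i1 i2 j : ℕ}
    (hi : i1 < i2) (hc : (i2, j) ∈ l) : (i1, j) ∈ μ := by
  rw [YoungDiagram.mem_iff_lt_rowLen] at hc ⊢
  exact (hc.trans_le (l.rowLen_anti (i1 + 1) i2 hi)).trans_le (h i1).1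

/-- Fill the boxes of the horizontal strip `l / μ` with an entry `N` exceeding those of `T`. -/
def extendTableau {μ l : YoungDiagram} (h : HorizontalStrip μ l) (N : ℕ)
    (T : SemistandardYoungTableau μ) (hT : ∀ i j, (i, j) ∈ μ → T i j < N) :
    SemistandardYoungTableau l where
  entry i j := if (i, j) ∈ μ then T i j else if (i, j) ∈ l then N else 0
  row_weak' := by
    intro i j1 j2 hj hc
    have hl : (i, j1) ∈ l := l.up_left_mem le_rfl hj.le hc
    by_cases h2 : (i, j2) ∈ μ
    · rw [if_pos h2, if_pos (μ.up_left_mem le_rfl hj.le h2)]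
      exact T.row_weak hj h2
    · rw [if_neg h2, if_pos hc]
      split_ifs with h1
      · exact (hT _ _ h1).le
      · exact le_rfl
  col_strict' := by
    intro i1 i2 j hi hc
    have h1 := h.mem_of_lt hi hc
    rw [if_pos h1, if_pos hc]
    split_ifs with h2
    · exact T.col_strict hi h2
    · exact hT _ _ h1
  zeros' := by
    intro i j hc
    rw [if_neg hc, if_neg fun hm => hc (h.le hm)]

theorem extendTableau_of_mem {μ l : YoungDiagram} (h : HorizontalStrip μ l) (N : ℕ)
    (T : SemistandardYoungTableau μ) (hT : ∀ i j, (i, j) ∈ μ → T i j < N) {i j : ℕ}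
    (hc : (i, j) ∈ μ) : extendTableau h N T hT i j = T i j := if_pos hc

theorem extendTableau_of_notMem {μ l : YoungDiagram} (h : HorizontalStrip μ l) (N : ℕ)
    (T : SemistandardYoungTableau μ) (hT : ∀ i j, (i, j) ∈ μ → T i j < N) {i j : ℕ}
    (hc : (i, j) ∉ μ) (hl : (i, j) ∈ l) : extendTableau h N T hT i j = N :=
  (if_neg hc).trans (if_pos hl)

theorem mem_iff_extendTableau_lt {μ l : YoungDiagram} (h : HorizontalStrip μ l) (N : ℕ)
    (T : SemistandardYoungTableau μ) (hT : ∀ i j, (i, j) ∈ μ → T i j < N) {i j : ℕ} :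
    (i, j) ∈ μ ↔ (i, j) ∈ l ∧ extendTableau h N T hT i j < N := by
  constructor
  · intro hc
    rw [extendTableau_of_mem h N T hT hc]
    exact ⟨h.le hc, hT _ _ hc⟩
  · rintro ⟨hl, hlt⟩
    by_contra hc
    rw [extendTableau_of_notMem h N T hT hc hl] at hlt
    exact lt_irrefl _ hlt

theorem weight_extendTableau {μ l : YoungDiagram} (h : HorizontalStrip μ l) (N : ℕ)
    (T : SemistandardYoungTableau μ) (hT : ∀ i j, (i, j) ∈ μ → T i j < N) :
    weight (extendTableau h N T hT) = weight T + Finsupp.single N (l.card - μ.card) := by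
  have hsub : μ.cells ⊆ l.cells := YoungDiagram.cells_subset_iff.mpr h.le
  rw [weight, ← Finset.sum_sdiff hsub, add_comm]
  congr 1
  · refine Finset.sum_congr rfl fun c hc => ?_
    rw [extendTableau_of_mem h N T hT hc]
  · rw [Finset.sum_congr rfl (g := fun _ => Finsupp.single N 1), Finset.sum_const,
      Finset.card_sdiff_of_subset hsub, Finsupp.smul_single, smul_eq_mul, mul_one]
    intro c hc
    rw [Finset.mem_sdiff] at hc
    rw [extendTableau_of_notMem h N T hT hc.2 hc.1]

theorem entry_lt_of_weight {μ : YoungDiagram} {T : SemistandardYoungTableau μ} {γ : ℕ →₀ ℕ}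
    (hT : weight T = γ) {N : ℕ} (hγ : ∀ k, N ≤ k → γ k = 0) (i j : ℕ) (hc : (i, j) ∈ μ) :
    T i j < N := by
  by_contra! h
  exact weight_entry_ne_zero T hc (hT ▸ hγ _ h)

/-- A tableau with entries at most `N` restricts to a tableau with entries less than `N`, and the
boxes with entry `N` form a horizontal strip. -/
theorem exists_extendTableau {l : YoungDiagram} (T : SemistandardYoungTableau l) (N : ℕ)
    (hT : ∀ i j, (i, j) ∈ l → T i j ≤ N) :
    ∃ (μ : YoungDiagram) (h : HorizontalStrip μ l) (T' : SemistandardYoungTableau μ)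
      (hT' : ∀ i j, (i, j) ∈ μ → T' i j < N), extendTableau h N T' hT' = T := by
  let μ : YoungDiagram :=
    { cells := l.cells.filter fun c => T c.1 c.2 < N
      isLowerSet := by
        rintro ⟨i, j⟩ ⟨i', j'⟩ ⟨hi, hj⟩ hc
        simp only [Finset.coe_filter, Set.mem_ofPred_eq, YoungDiagram.mem_cells] at hi hj hc ⊢
        refine ⟨l.up_left_mem hi hj hc.1, lt_of_le_of_lt ?_ hc.2⟩
        exact (T.row_weak_of_le hj (l.up_left_mem hi le_rfl hc.1)).trans (T.col_weak hi hc.1) }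
  have hmem : ∀ i j, (i, j) ∈ μ ↔ (i, j) ∈ l ∧ T i j < N := by
    intro i j
    rw [← YoungDiagram.mem_cells, ← YoungDiagram.mem_cells]
    exact Finset.mem_filter
  have hle : μ ≤ l := fun ⟨i, j⟩ hc => ((hmem i j).mp hc).1
  have h : HorizontalStrip μ l := by
    intro k
    refine ⟨?_, le_iff_rowLen_le.mp hle k⟩
    by_contra! hlt
    have hc : (k + 1, μ.rowLen k) ∈ l := YoungDiagram.mem_iff_lt_rowLen.mpr hlt
    have : (k, μ.rowLen k) ∈ μ := (hmem _ _).mpr ⟨l.up_left_mem (Nat.le_succ k) le_rfl hc,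
      (T.col_strict (Nat.lt_succ_self k) hc).trans_le (hT _ _ hc)⟩
    exact lt_irrefl _ (YoungDiagram.mem_iff_lt_rowLen.mp this)
  let T' : SemistandardYoungTableau μ :=
    { entry := fun i j => if (i, j) ∈ μ then T i j else 0
      row_weak' := by
        intro i j1 j2 hj hc
        rw [if_pos hc, if_pos (μ.up_left_mem le_rfl hj.le hc)]
        exact T.row_weak hj (hle hc)
      col_strict' := by
        intro i1 i2 j hi hc
        rw [if_pos hc, if_pos (μ.up_left_mem hi.le le_rfl hc)]
        exact T.col_strict hi (hle hc)
      zeros' := fun hc => if_neg hc }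
  have hval : ∀ i j, (i, j) ∈ μ → T' i j = T i j := fun i j hc => if_pos hc
  have hT' : ∀ i j, (i, j) ∈ μ → T' i j < N := fun i j hc => by
    rw [hval i j hc]; exact ((hmem i j).mp hc).2
  refine ⟨μ, h, T', hT', ?_⟩
  apply SemistandardYoungTableau.ext
  intro i j
  by_cases hc : (i, j) ∈ μ
  · rw [extendTableau_of_mem h N T' hT' hc, hval i j hc]
  · by_cases hl : (i, j) ∈ l
    · rw [extendTableau_of_notMem h N T' hT' hc hl]
      have h1 := hT i j hl
      have h2 : ¬ T i j < N := fun hlt => hc ((hmem i j).mpr ⟨hl, hlt⟩)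
      omega
    · rw [T.zeros hl, SemistandardYoungTableau.zeros _ hl]

/-- The branching rule: the boxes of a tableau that contain the largest entry form a horizontal
strip, and the other boxes an arbitrary smaller tableau. -/
theorem kostka_add_single (l : YoungDiagram) {N : ℕ} (d : ℕ) {γ : ℕ →₀ ℕ}
    (hγ : ∀ k, N ≤ k → γ k = 0) (B : Finset YoungDiagram) (hB : ∀ μ, HorizontalStrip μ l → μ ∈ B) :
    kostka l (γ + Finsupp.single N d) =
      ∑ μ ∈ B, if HorizontalStrip μ l ∧ μ.card + d = l.card then kostka μ γ else 0 := by
  rw [← Finset.sum_filter, ← Finset.sum_coe_sort]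
  set S := B.filter fun μ => HorizontalStrip μ l ∧ μ.card + d = l.card with hS
  have hP : ∀ μ : S, HorizontalStrip μ.1 l ∧ μ.1.card + d = l.card := fun μ =>
    (Finset.mem_filter.mp μ.2).2
  let F : (Σ μ : S, {T : SemistandardYoungTableau μ.1 // weight T = γ}) →
      {T : SemistandardYoungTableau l // weight T = γ + Finsupp.single N d} := fun p =>
    ⟨extendTableau (hP p.1).1 N p.2.1 (entry_lt_of_weight p.2.2 hγ), by
      have := (hP p.1).2
      rw [weight_extendTableau, p.2.2]
      congr 2
      omega⟩
  have hF : Function.Bijective F := by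
    constructor
    · rintro ⟨⟨μ, hμ⟩, T, hT⟩ ⟨⟨μ', hμ'⟩, T', hT'⟩ he
      have he' := congrArg Subtype.val he
      simp only [F] at he'
      have hμe : μ = μ' := by
        apply SetLike.ext
        rintro ⟨i, j⟩
        rw [mem_iff_extendTableau_lt (hP ⟨μ, hμ⟩).1 N T (entry_lt_of_weight hT hγ),
          mem_iff_extendTableau_lt (hP ⟨μ', hμ'⟩).1 N T' (entry_lt_of_weight hT' hγ), he']
      subst hμe
      have : T = T' := by
        apply SemistandardYoungTableau.ext
        intro i j
        by_cases hc : (i, j) ∈ μ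
        · rw [← extendTableau_of_mem (hP ⟨μ, hμ⟩).1 N T (entry_lt_of_weight hT hγ) hc,
            ← extendTableau_of_mem (hP ⟨μ, hμ⟩).1 N T' (entry_lt_of_weight hT' hγ) hc, he']
        · rw [T.zeros hc, T'.zeros hc]
      subst this
      rfl
    · rintro ⟨T, hT⟩
      obtain ⟨μ, h, T', hT', rfl⟩ := exists_extendTableau T N (by
        intro i j hc
        by_contra! hlt
        apply weight_entry_ne_zero T hc
        rw [hT, Finsupp.add_apply, hγ _ hlt.le, Finsupp.single_eq_of_ne (by omega), add_zero])
      rw [weight_extendTableau] at hT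
      have hTN : weight T' N = 0 := by
        rw [weight_apply, Finset.card_eq_zero, Finset.filter_eq_empty_iff]
        intro c hc he
        have := hT' c.1 c.2 hc
        omega
      have hd : l.card - μ.card = d := by
        have := DFunLike.congr_fun hT N
        simpa [hTN, hγ N le_rfl] using this
      rw [hd] at hT
      have hw : weight T' = γ := add_right_cancel hT
      have hcard : μ.card ≤ l.card :=
        Finset.card_le_card (YoungDiagram.cells_subset_iff.mpr h.le)
      have hmS : μ ∈ S := Finset.mem_filter.mpr ⟨hB μ h, h, by omega⟩
      exact ⟨⟨⟨μ, hmS⟩, ⟨T', hw⟩⟩, rfl⟩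
  rw [kostka, ← Nat.card_congr (Equiv.ofBijective F hF), Nat.card_sigma]
  rfl

/-! ### Symmetry of the Kostka numbers -/

/-- The Bender-Knuth reflection, in terms of row lengths: given `ν ≺ μ ≺ l`, the `k`-th row length
of `μ` varies independently of the others in the interval from `max l_{k+1} ν_k` to
`min l_k ν_{k-1}`, and is reflected in this interval. -/
theorem exists_reflection {ν μ l : YoungDiagram} (h1 : HorizontalStrip ν μ)
    (h2 : HorizontalStrip μ l) :
    ∃ μ', HorizontalStrip ν μ' ∧ HorizontalStrip μ' l ∧ μ'.card + μ.card = l.card + ν.card ∧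
      ∀ k, μ'.rowLen k + μ.rowLen k = max (l.rowLen (k + 1)) (ν.rowLen k) +
        if k = 0 then l.rowLen 0 else min (l.rowLen k) (ν.rowLen (k - 1)) := by
  set U : ℕ → ℕ := fun k => if k = 0 then l.rowLen 0 else min (l.rowLen k) (ν.rowLen (k - 1))
    with hU
  have hU0 : U 0 = l.rowLen 0 := by simp [hU]
  have hUs : ∀ k, U (k + 1) = min (l.rowLen (k + 1)) (ν.rowLen k) := fun k => by simp [hU]
  have hUle : ∀ k, U k ≤ l.rowLen k := by
    rintro (_ | k)
    · exact hU0.le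
    · rw [hUs]; exact min_le_left _ _
  have hup : ∀ k, μ.rowLen k ≤ U k := by
    rintro (_ | k)
    · rw [hU0]; exact (h2 0).2
    · rw [hUs]; exact le_min (h2 _).2 (h1 k).1
  have hlow : ∀ k, max (l.rowLen (k + 1)) (ν.rowLen k) ≤ μ.rowLen k := fun k =>
    max_le (h2 k).1 (h1 k).2
  obtain ⟨M, hM⟩ : ∃ M, l.rowLen M = 0 := ⟨_, rowLen_colLen_zero l⟩
  obtain ⟨μ', hμ'⟩ := exists_rowLen_eq
    (fun k => max (l.rowLen (k + 1)) (ν.rowLen k) + U k - μ.rowLen k)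
    (antitone_nat_of_succ_le fun k => by
      have e1 := hlow (k + 1)
      have e2 := hup k
      have e3 := hUs k
      omega) M (by
      have e1 := hlow M
      have e2 := (h2 M).2
      have e3 := hUle M
      omega)
  have hsum : ∀ k, μ'.rowLen k + μ.rowLen k = max (l.rowLen (k + 1)) (ν.rowLen k) + U k := by
    intro k
    have e1 := hup k
    rw [hμ' k]
    omega
  refine ⟨μ', fun k => ?_, fun k => ?_, ?_, hsum⟩
  · have e1 := hsum k
    have e2 := hsum (k + 1)
    have e3 := hlow (k + 1)
    have e4 := hup k
    have e5 := hUs k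
    omega
  · have e1 := hsum k
    have e3 := hlow k
    have e4 := hup k
    have e5 := hUle k
    omega
  · have tele : ∀ m, ∑ k ∈ Finset.range m, (max (l.rowLen (k + 1)) (ν.rowLen k) + U k) + U m =
        ∑ k ∈ Finset.range m, (l.rowLen k + ν.rowLen k) + l.rowLen m := by
      intro m
      induction m with
      | zero => simpa using hU0
      | succ m ih =>
        rw [Finset.sum_range_succ, Finset.sum_range_succ]
        have := hUs m
        omega
    have hM1 : μ.rowLen M = 0 := by have := (h2 M).2; omega
    have hM2 : ν.rowLen M = 0 := by have := (h1 M).2; omega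
    have hM3 : U M = 0 := by have := hUle M; omega
    have hM4 : μ'.rowLen M = 0 := by
      have := hsum M
      have := hlow M
      omega
    have := tele M
    rw [card_eq_sum_rowLen μ hM1, card_eq_sum_rowLen μ' hM4, card_eq_sum_rowLen l hM,
      card_eq_sum_rowLen ν hM2, ← Finset.sum_add_distrib, ← Finset.sum_add_distrib,
      Finset.sum_congr rfl fun k _ => hsum k]
    omega

/-- The diagrams `μ` with `ν ≺ μ ≺ l` whose two strips have `a` and `b` boxes. -/
def between (ν l : YoungDiagram) (a b : ℕ) : Finset YoungDiagram :=
  (below l).filter fun μ => (HorizontalStrip μ l ∧ μ.card + b = l.card) ∧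
    (HorizontalStrip ν μ ∧ ν.card + a = μ.card)

theorem card_between_le (ν l : YoungDiagram) (a b : ℕ) :
    (between ν l a b).card ≤ (between ν l b a).card := by
  choose! f hf using fun (μ : YoungDiagram) (h : HorizontalStrip ν μ ∧ HorizontalStrip μ l) =>
    exists_reflection h.1 h.2
  have hb : ∀ {μ}, μ ∈ between ν l a b → HorizontalStrip ν μ ∧ HorizontalStrip μ l := by
    intro μ h
    have := (Finset.mem_filter.mp h).2
    exact ⟨this.2.1, this.1.1⟩
  refine Finset.card_le_card_of_injOn f ?_ ?_
  · intro μ hμ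
    obtain ⟨e1, e2, e3, e4⟩ := hf μ (hb hμ)
    have := (Finset.mem_filter.mp hμ).2
    refine Finset.mem_filter.mpr ⟨mem_below.mpr e2.le, ⟨e2, ?_⟩, e1, ?_⟩ <;> omega
  · intro μ hμ μ' hμ' he
    apply diagram_ext
    intro k
    have e1 := (hf μ (hb hμ)).2.2.2 k
    have e2 := (hf μ' (hb hμ')).2.2.2 k
    rw [he] at e1
    omega

theorem card_between_comm (ν l : YoungDiagram) (a b : ℕ) :
    (between ν l a b).card = (between ν l b a).card :=
  le_antisymm (card_between_le ν l a b) (card_between_le ν l b a)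

theorem kostka_add_two_singles (l : YoungDiagram) {N : ℕ} (a b : ℕ) {γ : ℕ →₀ ℕ}
    (hγ : ∀ k, N ≤ k → γ k = 0) :
    kostka l (γ + Finsupp.single N a + Finsupp.single (N + 1) b) =
      ∑ ν ∈ below l, (between ν l a b).card * kostka ν γ := by
  rw [kostka_add_single l b (B := below l) _ fun μ h => mem_below.mpr h.le]
  · rw [Finset.sum_congr rfl fun μ hμ => by
      rw [kostka_add_single μ a hγ (below l) fun ν h => mem_below.mpr
        (h.le.trans (mem_below.mp hμ))]]
    simp_rw [between, Finset.card_filter, Finset.sum_mul]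
    rw [Finset.sum_comm]
    refine Finset.sum_congr rfl fun μ _ => ?_
    by_cases h : HorizontalStrip μ l ∧ μ.card + b = l.card
    · simp only [h, true_and, and_self, if_true, ite_mul, one_mul, zero_mul]
    · simp only [h, false_and, if_false, zero_mul, Finset.sum_const_zero]
  · intro k hk
    rw [Finsupp.add_apply, hγ k (by omega), Finsupp.single_eq_of_ne (by omega), add_zero]

theorem mapDomain_swap_of_lt {N : ℕ} {γ : ℕ →₀ ℕ} (hγ : ∀ k, N ≤ k → γ k = 0) :
    γ.mapDomain (Equiv.swap N (N + 1)) = γ := by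
  ext k
  rw [Finsupp.mapDomain_equiv_apply, Equiv.symm_swap]
  rcases Nat.lt_or_ge k N with h | h
  · rw [Equiv.swap_apply_of_ne_of_ne (by omega) (by omega)]
  · rw [hγ k h, hγ]
    rw [Equiv.swap_apply_def]
    split_ifs <;> omega

theorem eq_add_singles {N : ℕ} {δ : ℕ →₀ ℕ} (hδ : ∀ k, N + 1 ≤ k → δ k = 0) :
    ∃ γ : ℕ →₀ ℕ, (∀ k, N ≤ k → γ k = 0) ∧ δ = γ + Finsupp.single N (δ N) := by
  refine ⟨δ.erase N, fun k hk => ?_, (Finsupp.erase_add_single N δ).symm⟩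
  rcases Nat.eq_or_lt_of_le hk with rfl | h
  · exact Finsupp.erase_same
  · rw [Finsupp.erase_ne (by omega), hδ k h]

theorem exists_bound (γ : ℕ →₀ ℕ) : ∃ N, ∀ k, N ≤ k → γ k = 0 := by
  obtain ⟨N, hN⟩ := γ.support.exists_nat_subset_range
  refine ⟨N, fun k hk => ?_⟩
  by_contra hne
  have := Finset.mem_range.mp (hN (Finsupp.mem_support_iff.mpr hne))
  omega

/-- Exponents beyond the two swapped ones are split off by the branching rule. -/
theorem kostka_mapDomain_swap (l : YoungDiagram) (N : ℕ) (δ : ℕ →₀ ℕ) :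
    kostka l (δ.mapDomain (Equiv.swap N (N + 1))) = kostka l δ := by
  obtain ⟨m, hm⟩ : ∃ m, ∀ k, N + 2 + m ≤ k → δ k = 0 := by
    obtain ⟨m, hm⟩ := exists_bound δ
    exact ⟨m, fun k hk => hm k (by omega)⟩
  induction m generalizing l δ with
  | zero =>
    obtain ⟨γ1, h1, e1⟩ := eq_add_singles (N := N + 1) hm
    obtain ⟨γ, h2, e2⟩ := eq_add_singles (N := N) h1
    rw [e1, e2, Finsupp.mapDomain_add, Finsupp.mapDomain_add, mapDomain_swap_of_lt h2,
      Finsupp.mapDomain_single, Finsupp.mapDomain_single, Equiv.swap_apply_left,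
      Equiv.swap_apply_right, add_right_comm, kostka_add_two_singles _ _ _ h2,
      kostka_add_two_singles _ _ _ h2]
    simp_rw [card_between_comm]
  | succ m ih =>
    obtain ⟨γ, h1, e1⟩ := eq_add_singles (N := N + 2 + m) hm
    rw [e1, Finsupp.mapDomain_add, Finsupp.mapDomain_single,
      Equiv.swap_apply_of_ne_of_ne (by omega) (by omega),
      kostka_add_single l _ h1 (below l) fun μ h => mem_below.mpr h.le,
      kostka_add_single l _ _ (below l) fun μ h => mem_below.mpr h.le]
    · exact Finset.sum_congr rfl fun μ _ => by rw [ih μ γ h1]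
    · intro k hk
      rw [Finsupp.mapDomain_equiv_apply, Equiv.symm_swap,
        Equiv.swap_apply_of_ne_of_ne (by omega) (by omega), h1 k hk]

/-- The permutations of the variables that preserve all Kostka numbers. -/
def kostkaStabilizer : Subgroup (Equiv.Perm ℕ) where
  carrier := {e | ∀ l δ, kostka l (δ.mapDomain e) = kostka l δ}
  one_mem' := fun l δ => by
    rw [Equiv.Perm.coe_one, Finsupp.mapDomain_id]
  mul_mem' := fun {e e'} h h' l δ => by
    rw [Equiv.Perm.coe_mul, Finsupp.mapDomain_comp, h, h']
  inv_mem' := fun {e} h l δ => by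
    rw [← h, ← Finsupp.mapDomain_comp, ← Equiv.Perm.coe_mul, mul_inv_cancel, Equiv.Perm.coe_one,
      Finsupp.mapDomain_id]

theorem swap_mem_kostkaStabilizer (i j : ℕ) : Equiv.swap i j ∈ kostkaStabilizer := by
  wlog h : i ≤ j generalizing i j
  · rw [Equiv.swap_comm]; exact this j i (by omega)
  obtain ⟨m, rfl⟩ := Nat.exists_eq_add_of_le h
  induction m with
  | zero =>
    rw [add_zero, Equiv.swap_self]
    exact kostkaStabilizer.one_mem
  | succ m ih =>
    have hadj : Equiv.swap (i + m) (i + m + 1) ∈ kostkaStabilizer :=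
      fun l δ => kostka_mapDomain_swap l _ δ
    rcases Nat.eq_zero_or_pos m with rfl | hm
    · exact hadj
    · have := Equiv.swap_mul_swap_mul_swap (x := i) (y := i + m) (z := i + m + 1) (by omega)
        (by omega)
      rw [← add_assoc, Equiv.swap_comm i, ← this]
      exact mul_mem (mul_mem hadj (ih (by omega))) hadj

/-- On a finite set, every permutation agrees with a product of transpositions. -/
theorem exists_mem_kostkaStabilizer (e : Equiv.Perm ℕ) (s : Finset ℕ) :
    ∃ g ∈ kostkaStabilizer, ∀ k ∈ s, g k = e k := by
  induction s using Finset.induction with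
  | empty => exact ⟨1, one_mem _, by simp⟩
  | insert a s ha ih =>
    obtain ⟨g, hg, h⟩ := ih
    refine ⟨Equiv.swap (g a) (e a) * g, mul_mem (swap_mem_kostkaStabilizer _ _) hg, ?_⟩
    intro k hk
    rw [Equiv.Perm.mul_apply]
    rcases Finset.mem_insert.mp hk with rfl | hks
    · exact Equiv.swap_apply_left _ _
    · have hka : k ≠ a := by rintro rfl; exact ha hks
      rw [Equiv.swap_apply_of_ne_of_ne (fun he => hka (g.injective he)), h k hks]
      rw [h k hks]
      exact fun he => hka (e.injective he)

theorem kostka_mapDomain (l : YoungDiagram) (e : Equiv.Perm ℕ) (δ : ℕ →₀ ℕ) :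
    kostka l (δ.mapDomain e) = kostka l δ := by
  obtain ⟨g, hg, h⟩ := exists_mem_kostkaStabilizer e δ.support
  rw [← hg l δ]
  congr 1
  exact Finsupp.mapDomain_congr fun k hk => (h k hk).symm

theorem coeff_mapDomain_rename (e : Equiv.Perm ℕ) (p : MvPowerSeries ℕ ℚ) (δ : ℕ →₀ ℕ) :
    MvPowerSeries.coeff (δ.mapDomain e) (MvPowerSeries.rename e p) = MvPowerSeries.coeff δ p := by
  have := MvPowerSeries.coeff_embDomain_rename e.toEmbedding p δ
  rwa [Finsupp.embDomain_eq_mapDomain] at this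

theorem schur_mem_symmetricFunctions (l : YoungDiagram) : schur l ∈ symmetricFunctions := by
  refine ⟨fun e => ?_, l.card, fun γ hγ => ?_⟩
  · ext γ
    obtain ⟨δ, rfl⟩ : ∃ δ : ℕ →₀ ℕ, δ.mapDomain e = γ :=
      ⟨γ.mapDomain e.symm, by rw [← Finsupp.mapDomain_comp]; simp⟩
    rw [coeff_mapDomain_rename, coeff_schur, coeff_schur, kostka_mapDomain]
  · rw [coeff_schur, kostka_eq_zero_of_degree hγ.ne', Nat.cast_zero]

/-! ### Removing a box and differentiating the Schur functions -/

theorem exists_addsBox_of_card {ν l : YoungDiagram} (h : ν ≤ l) (hc : ν.card + 1 = l.card) :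
    ∃ i, AddsBox ν i l := by
  have hsub : ν.cells ⊆ l.cells := YoungDiagram.cells_subset_iff.mpr h
  have hcard : (l.cells \ ν.cells).card = 1 := by
    rw [Finset.card_sdiff_of_subset hsub]
    show l.card - ν.card = 1
    omega
  obtain ⟨⟨i, j⟩, hij⟩ := Finset.card_eq_one.mp hcard
  have hmem : ∀ a b, (b < l.rowLen a ∧ ¬ b < ν.rowLen a) ↔ (a = i ∧ b = j) := by
    intro a b
    have := Finset.ext_iff.mp hij (a, b)
    rwa [Finset.mem_sdiff, YoungDiagram.mem_cells, YoungDiagram.mem_cells,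
      YoungDiagram.mem_iff_lt_rowLen, YoungDiagram.mem_iff_lt_rowLen, Finset.mem_singleton,
      Prod.mk.injEq] at this
  refine ⟨i, fun k => ?_⟩
  have hle := le_iff_rowLen_le.mp h k
  have h1 := hmem k (ν.rowLen k)
  have h2 := hmem k (ν.rowLen k + 1)
  have h3 := hmem i j
  split_ifs with hk
  · subst hk; omega
  · omega

theorem sum_addsBox (ν l : YoungDiagram) {M : ℕ} (hM : l.rowLen M = 0) (a : ℚ) :
    (∑ i ∈ Finset.range M, if AddsBox ν i l then a else 0) =
      if HorizontalStrip ν l ∧ ν.card + 1 = l.card then a else 0 := by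
  by_cases h : HorizontalStrip ν l ∧ ν.card + 1 = l.card
  · obtain ⟨i, hi⟩ := exists_addsBox_of_card h.1.le h.2
    rw [if_pos h, Finset.sum_eq_single i, if_pos hi]
    · intro k _ hk
      rw [if_neg]
      intro hk'
      have e1 := hi k
      have e2 := hk' k
      rw [if_neg hk] at e1
      rw [if_pos rfl] at e2
      omega
    · intro hn
      have := rowLen_eq_zero_of_le hM (by simpa using hn : M ≤ i)
      have := hi.pos
      omega
  · rw [if_neg h]
    refine Finset.sum_eq_zero fun i _ => if_neg fun hi => h ⟨hi.horizontalStrip, hi.card.symm⟩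

/-- A strip with a single box is a removable box. So on monomials in the first `N` variables, `∂_N`
of a Schur function is the sum of the Schur functions with one box removed. -/
theorem kostka_add_single_one (l : YoungDiagram) {N : ℕ} {γ : ℕ →₀ ℕ}
    (hγ : ∀ k, N ≤ k → γ k = 0) :
    (kostka l (γ + Finsupp.single N 1) : ℚ) =
      ∑ c ∈ (removable l).attach, (kostka (removeBox l c.1 c.2) γ : ℚ) := by
  have h := sum_removable (fun _ => 1) (fun μ => (kostka μ γ : ℚ)) l (below l)
    (fun ν i h => mem_below.mpr h.le) _ (rowLen_colLen_zero l)
  simp only [one_mul] at h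
  rw [h, kostka_add_single l 1 hγ (below l) fun μ h => mem_below.mpr h.le, Nat.cast_sum]
  refine Finset.sum_congr rfl fun ν _ => ?_
  rw [sum_addsBox ν l (rowLen_colLen_zero l), Nat.cast_ite, Nat.cast_zero]

theorem exists_addsBox_strip_iff {ν l : YoungDiagram} {i : ℕ} :
    (∃ μ, AddsBox ν i μ ∧ HorizontalStrip μ l) ↔
      ∀ k, l.rowLen (k + 1) ≤ ν.rowLen k + (if k = i then 1 else 0) ∧
        ν.rowLen k + (if k = i then 1 else 0) ≤ l.rowLen k := by
  constructor
  · rintro ⟨μ, h1, h2⟩ k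
    rw [← h1 k]
    exact h2 k
  · intro h
    obtain ⟨μ, hμ⟩ := exists_rowLen_eq (fun k => ν.rowLen k + if k = i then 1 else 0)
      (antitone_nat_of_succ_le fun k => (h (k + 1)).2.trans (h k).1) (l.colLen 0)
      (by have := (h (l.colLen 0)).2; rw [rowLen_colLen_zero] at this; omega)
    refine ⟨μ, hμ, fun k => ?_⟩
    rw [hμ k]
    exact h k

theorem exists_strip_addsBox_iff {ν l : YoungDiagram} {i : ℕ} :
    (∃ κ, AddsBox κ i l ∧ HorizontalStrip ν κ) ↔
      ∀ k, l.rowLen (k + 1) ≤ ν.rowLen k + (if k + 1 = i then 1 else 0) ∧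
        ν.rowLen k + (if k = i then 1 else 0) ≤ l.rowLen k := by
  constructor
  · rintro ⟨κ, h1, h2⟩ k
    have e1 := h1 k
    have e2 := h1 (k + 1)
    have e3 := h2 k
    omega
  · intro h
    obtain ⟨κ, hκ⟩ := exists_rowLen_eq (fun k => l.rowLen k - if k = i then 1 else 0)
      (antitone_nat_of_succ_le fun k => by have := h k; omega) (l.colLen 0)
      (by rw [rowLen_colLen_zero, Nat.zero_sub])
    refine ⟨κ, fun k => ?_, fun k => ?_⟩
    · have e1 := hκ k
      have e2 := (h k).2
      omega
    · have e1 := hκ k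
      have e2 := hκ (k + 1)
      have e3 := h k
      omega

theorem sum_range_shift {f g : ℕ → ℚ} {M : ℕ} (h0 : g 0 = 0) (hM : g M = 0)
    (h : ∀ i, f i = g (i + 1)) : ∑ i ∈ Finset.range M, f i = ∑ i ∈ Finset.range M, g i := by
  have := (Finset.sum_range_succ' g M).symm.trans (Finset.sum_range_succ g M)
  rw [h0, hM, add_zero, add_zero] at this
  rw [← this]
  exact Finset.sum_congr rfl fun i _ => h i

/-- Weighted comparison of the two ways to interpolate between `ν` and `l`: adding a box to `ν`
such that a horizontal strip remains, and removing a box from `l` such that a horizontal strip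
remains. -/
theorem strip_identity {ν l : YoungDiagram} {d : ℕ} (hd : ν.card + d + 1 = l.card) {M : ℕ}
    (hM : l.rowLen M = 0) (N : ℚ) :
    (∑ i ∈ Finset.range M, if ∃ μ, AddsBox ν i μ ∧ HorizontalStrip μ l then
        N + ν.rowLen i - i else 0) + (if HorizontalStrip ν l then (d : ℚ) + 1 else 0) =
      ∑ i ∈ Finset.range M, if ∃ κ, AddsBox κ i l ∧ HorizontalStrip ν κ then
        N + l.rowLen i - i else 0 := by
  simp only [exists_addsBox_strip_iff, exists_strip_addsBox_iff]
  by_cases h : HorizontalStrip ν l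
  · -- Both conditions say `ν_i < l_i`, and the weights differ by `l_i - ν_i`.
    have hνM : ν.rowLen M = 0 := by have := (h M).2; omega
    have hsum : (d : ℚ) + 1 = ∑ i ∈ Finset.range M, ((l.rowLen i : ℚ) - ν.rowLen i) := by
      rw [card_eq_sum_rowLen l hM, card_eq_sum_rowLen ν hνM] at hd
      rw [Finset.sum_sub_distrib, ← Nat.cast_sum, ← Nat.cast_sum, ← hd]
      push_cast
      ring
    rw [if_pos h, hsum, ← Finset.sum_add_distrib]
    refine Finset.sum_congr rfl fun i _ => ?_
    rcases Nat.lt_or_ge (ν.rowLen i) (l.rowLen i) with hlt | hge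
    · rw [if_pos, if_pos]
      · ring
      · intro k
        have := h k
        split_ifs with h1 h2 h2 <;> first | omega | (subst h2; omega)
      · intro k
        have := h k
        split_ifs with h1 <;> first | omega | (subst h1; omega)
    · have heq : l.rowLen i = ν.rowLen i := le_antisymm hge (h i).2
      rw [if_neg, if_neg, heq]
      · ring
      · intro hc
        have := (hc i).2
        rw [if_pos rfl] at this
        omega
      · intro hc
        have := (hc i).2
        rw [if_pos rfl] at this
        omega
  · -- Adding a box in row `i` repairs the violation `ν_i < l_{i+1}`, as does removing the box of
    -- `l` in row `i + 1`; it is the same box up to a diagonal shift.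
    rw [if_neg h, add_zero]
    have hM1 : ¬ ∀ k, l.rowLen (k + 1) ≤ ν.rowLen k + (if k + 1 = M then 1 else 0) ∧
        ν.rowLen k + (if k = M then 1 else 0) ≤ l.rowLen k := by
      intro hc
      have := (hc M).2
      rw [if_pos rfl] at this
      omega
    have h0 : ¬ ∀ k, l.rowLen (k + 1) ≤ ν.rowLen k + (if k + 1 = 0 then 1 else 0) ∧
        ν.rowLen k + (if k = 0 then 1 else 0) ≤ l.rowLen k := by
      intro hc
      apply h
      intro k
      have := hc k
      rw [if_neg (by omega)] at this
      omega
    refine sum_range_shift (if_neg h0) (if_neg hM1) fun i => ?_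
    -- a row where the lower interlacing bound fails, provided that `ν ⊆ l`
    have hviol : ∃ k, (∀ m, ν.rowLen m ≤ l.rowLen m) → ν.rowLen k < l.rowLen (k + 1) := by
      by_contra! hc
      exact h fun k => ⟨(hc k).2, (hc k).1 k⟩
    obtain ⟨k₀, hk₀⟩ := hviol
    by_cases hA : ∀ k, l.rowLen (k + 1) ≤ ν.rowLen k + (if k = i then 1 else 0) ∧
        ν.rowLen k + (if k = i then 1 else 0) ≤ l.rowLen k
    · have hv := hk₀ fun m => by have := hA m; omega
      have hki : k₀ = i := by
        by_contra hne
        have := (hA k₀).1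
        rw [if_neg hne] at this
        omega
      subst hki
      have e1 := (hA k₀).1
      rw [if_pos rfl] at e1
      rw [if_pos hA, if_pos]
      · have : l.rowLen (k₀ + 1) = ν.rowLen k₀ + 1 := by omega
        rw [this]
        push_cast
        ring
      · intro k
        have e2 := hA k
        refine ⟨by simpa using e2.1, ?_⟩
        split_ifs with hk
        · subst hk
          have := ν.rowLen_anti k₀ (k₀ + 1) (Nat.le_succ _)
          omega
        · split_ifs at e2 <;> omega
    · rw [if_neg hA, if_neg]
      intro hB
      apply hA
      have hv := hk₀ fun m => by have := hB m; omega
      have hki : k₀ = i := by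
        by_contra hne
        have := (hB k₀).1
        rw [if_neg (by omega)] at this
        omega
      subst hki
      intro k
      have e2 := hB k
      refine ⟨by simpa using e2.1, ?_⟩
      split_ifs with hk
      · subst hk
        have := l.rowLen_anti k (k + 1) (Nat.le_succ _)
        omega
      · split_ifs at e2 <;> omega

theorem sum_ite_unique {ι : Type*} (s : Finset ι) (P : ι → Prop) [DecidablePred P]
    [Decidable (∃ i, P i)] (hs : ∀ i, P i → i ∈ s)
    (hP : ∀ i j, P i → P j → i = j) (a : ℚ) :
    (∑ i ∈ s, if P i then a else 0) = if ∃ i, P i then a else 0 := by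
  by_cases h : ∃ i, P i
  · obtain ⟨i, hi⟩ := h
    rw [if_pos ⟨i, hi⟩, Finset.sum_eq_single i, if_pos hi]
    · exact fun j _ hj => if_neg fun hj' => hj (hP j i hj' hi)
    · exact fun hn => absurd (hs i hi) hn
  · rw [if_neg h]
    exact Finset.sum_eq_zero fun i _ => if_neg fun hi => h ⟨i, hi⟩

theorem kostka_zero_right {l : YoungDiagram} (h : l ≠ ⊥) : kostka l 0 = 0 := by
  apply kostka_eq_zero_of_degree
  rw [map_zero]
  exact fun h0 => h (eq_bot_of_card_eq_zero h0.symm)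

/-- In `N` variables, the sum of all partial derivatives of a Schur polynomial is the sum of the
Schur polynomials with one box removed, weighted by `N` plus the content of the box. -/
theorem sum_kostka_add_single (N : ℕ) (l : YoungDiagram) {γ : ℕ →₀ ℕ}
    (hγ : ∀ k, N ≤ k → γ k = 0) :
    ∑ i ∈ Finset.range N, ((γ i : ℚ) + 1) * kostka l (γ + Finsupp.single i 1) =
      ∑ c ∈ (removable l).attach, ((N : ℚ) + ((c.1.2 : ℚ) - c.1.1)) *
        kostka (removeBox l c.1 c.2) γ := by
  induction N generalizing l γ with
  | zero =>
    have h0 : γ = 0 := Finsupp.ext fun k => hγ k (Nat.zero_le k)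
    subst h0
    rw [Finset.sum_range_zero, Finset.sum_eq_zero]
    rintro ⟨c, hc⟩ -
    by_cases hb : removeBox l c hc = ⊥
    · -- The removed box is the only one, hence has content `0`.
      have h1 := addsBox_removeBox hc
      rw [hb] at h1
      have hz : ∀ k, (⊥ : YoungDiagram).rowLen k = 0 := by
        intro k
        by_contra hne
        exact YoungDiagram.notMem_bot _
          (YoungDiagram.mem_iff_lt_rowLen.mpr (Nat.pos_of_ne_zero hne))
      have h2 := hz c.1
      have h3 : c.1 = 0 := by
        by_contra hne
        have e1 := h1.1 0
        have e2 := h1.1 c.1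
        have e3 := l.rowLen_anti 0 c.1 (Nat.zero_le _)
        rw [if_neg (Ne.symm hne), hz] at e1
        rw [if_pos rfl] at e2
        omega
      have h4 : c.2 = 0 := by rw [← h1.2, h2]
      simp [h3, h4]
    · rw [kostka_zero_right hb, Nat.cast_zero, mul_zero]
  | succ N ih =>
    obtain ⟨γ', h', e'⟩ := eq_add_singles hγ
    generalize γ N = d at e'
    subst e'
    set M := l.colLen 0
    have hM : l.rowLen M = 0 := rowLen_colLen_zero l
    -- the contribution of the last variable
    have hlast : (kostka l (γ' + Finsupp.single N d + Finsupp.single N 1) : ℚ) =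
        ∑ ν ∈ below l, if HorizontalStrip ν l ∧ ν.card + (d + 1) = l.card then
          (kostka ν γ' : ℚ) else 0 := by
      rw [add_assoc, ← Finsupp.single_add,
        kostka_add_single l _ h' (below l) fun μ h => mem_below.mpr h.le, Nat.cast_sum]
      exact Finset.sum_congr rfl fun ν _ => by rw [Nat.cast_ite, Nat.cast_zero]
    -- the contribution of the other variables, by induction
    have hother : ∀ i ∈ Finset.range N,
        (((γ' + Finsupp.single N d) i : ℚ) + 1) *
          kostka l (γ' + Finsupp.single N d + Finsupp.single i 1) =
        ∑ μ ∈ below l, if HorizontalStrip μ l ∧ μ.card + d = l.card then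
          ((γ' i : ℚ) + 1) * kostka μ (γ' + Finsupp.single i 1) else 0 := by
      intro i hi
      have hiN := Finset.mem_range.mp hi
      rw [Finsupp.add_apply, Finsupp.single_eq_of_ne (by omega), add_zero, add_right_comm,
        kostka_add_single l _ _ (below l) fun μ h => mem_below.mpr h.le, Nat.cast_sum,
        Finset.mul_sum]
      · refine Finset.sum_congr rfl fun ν _ => ?_
        rw [Nat.cast_ite, Nat.cast_zero, mul_ite, mul_zero]
      · intro k hk
        rw [Finsupp.add_apply, h' k hk, Finsupp.single_eq_of_ne (by omega), add_zero]
    have hfirst : ∑ i ∈ Finset.range N, (((γ' + Finsupp.single N d) i : ℚ) + 1) *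
          kostka l (γ' + Finsupp.single N d + Finsupp.single i 1) =
        ∑ ν ∈ below l, if ν.card + d + 1 = l.card then (∑ i ∈ Finset.range M,
          if ∃ μ, AddsBox ν i μ ∧ HorizontalStrip μ l then (N : ℚ) + ν.rowLen i - i else 0) *
            kostka ν γ' else 0 := by
      rw [Finset.sum_congr rfl hother, Finset.sum_comm]
      have : ∀ μ ∈ below l, (∑ i ∈ Finset.range N,
          if HorizontalStrip μ l ∧ μ.card + d = l.card then
            ((γ' i : ℚ) + 1) * kostka μ (γ' + Finsupp.single i 1) else 0) =
          ∑ ν ∈ below l, ∑ i ∈ Finset.range M, if AddsBox ν i μ ∧ HorizontalStrip μ l then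
            (if ν.card + d + 1 = l.card then ((N : ℚ) + ν.rowLen i - i) * kostka ν γ' else 0)
              else 0 := by
        intro μ hμ
        by_cases hc : HorizontalStrip μ l ∧ μ.card + d = l.card
        · simp only [if_pos hc]
          have hMμ : μ.rowLen M = 0 := by have := le_iff_rowLen_le.mp hc.1.le M; omega
          rw [ih μ h', sum_removable (fun c => (N : ℚ) + ((c.2 : ℚ) - c.1))
            (fun ν => (kostka ν γ' : ℚ)) μ (below l)
            (fun ν i h => mem_below.mpr (h.le.trans (mem_below.mp hμ))) M hMμ]
          refine Finset.sum_congr rfl fun ν _ => Finset.sum_congr rfl fun i _ => ?_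
          by_cases ha : AddsBox ν i μ
          · have := ha.card
            rw [if_pos ha, if_pos ⟨ha, hc.1⟩, if_pos (by omega)]
            ring
          · rw [if_neg ha, if_neg fun h => ha h.1]
        · simp only [if_neg hc, Finset.sum_const_zero]
          symm
          refine Finset.sum_eq_zero fun ν _ => Finset.sum_eq_zero fun i _ => ?_
          split_ifs with h1 h2
          · exact absurd ⟨h1.2, by have := h1.1.card; omega⟩ hc
          · rfl
          · rfl
      rw [Finset.sum_congr rfl this, Finset.sum_comm]
      refine Finset.sum_congr rfl fun ν _ => ?_
      rw [Finset.sum_comm, Finset.sum_congr rfl fun i _ => sum_ite_unique (below l)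
        (fun μ => AddsBox ν i μ ∧ HorizontalStrip μ l) (fun μ h => mem_below.mpr h.2.le)
        (fun μ μ' h h' => h.1.unique_right h'.1)
        (if ν.card + d + 1 = l.card then ((N : ℚ) + ν.rowLen i - i) * kostka ν γ' else 0)]
      split_ifs with hc
      · rw [Finset.sum_mul]
        exact Finset.sum_congr rfl fun i _ => by rw [ite_mul, zero_mul]
      · simp
    -- the right-hand side, expanded by the branching rule
    have hright : ∑ c ∈ (removable l).attach, (((N + 1 : ℕ) : ℚ) + ((c.1.2 : ℚ) - c.1.1)) *
          kostka (removeBox l c.1 c.2) (γ' + Finsupp.single N d) =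
        ∑ ν ∈ below l, if ν.card + d + 1 = l.card then (∑ i ∈ Finset.range M,
          if ∃ κ, AddsBox κ i l ∧ HorizontalStrip ν κ then (N : ℚ) + l.rowLen i - i else 0) *
            kostka ν γ' else 0 := by
      rw [sum_removable (fun c => ((N + 1 : ℕ) : ℚ) + ((c.2 : ℚ) - c.1))
        (fun ν => (kostka ν (γ' + Finsupp.single N d) : ℚ)) l (below l)
        (fun ν i h => mem_below.mpr h.le) M hM]
      have : ∀ κ ∈ below l, (∑ i ∈ Finset.range M, if AddsBox κ i l then
            (((N + 1 : ℕ) : ℚ) + ((κ.rowLen i : ℚ) - i)) * kostka κ (γ' + Finsupp.single N d)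
              else 0) =
          ∑ ν ∈ below l, ∑ i ∈ Finset.range M, if AddsBox κ i l ∧ HorizontalStrip ν κ then
            (if ν.card + d + 1 = l.card then ((N : ℚ) + l.rowLen i - i) * kostka ν γ' else 0)
              else 0 := by
        intro κ hκ
        rw [Finset.sum_comm]
        refine Finset.sum_congr rfl fun i _ => ?_
        by_cases ha : AddsBox κ i l
        · rw [if_pos ha, kostka_add_single κ d h' (below l) fun μ h => mem_below.mpr
            (h.le.trans (mem_below.mp hκ)), Nat.cast_sum, Finset.mul_sum]
          refine Finset.sum_congr rfl fun ν _ => ?_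
          have e1 := ha.card
          have e2 := ha i
          rw [if_pos rfl] at e2
          by_cases hs : HorizontalStrip ν κ
          · rw [if_pos (show AddsBox κ i l ∧ HorizontalStrip ν κ from ⟨ha, hs⟩)]
            by_cases hc : ν.card + d + 1 = l.card
            · rw [if_pos hc, if_pos ⟨hs, by omega⟩, e2]
              push_cast
              ring
            · rw [if_neg hc, if_neg (show ¬(HorizontalStrip ν κ ∧ ν.card + d = κ.card) from
                fun h => hc (by have := h.2; omega)), Nat.cast_zero, mul_zero]
          · rw [if_neg (show ¬(HorizontalStrip ν κ ∧ ν.card + d = κ.card) from fun h => hs h.1),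
              if_neg fun h => hs h.2, Nat.cast_zero, mul_zero]
        · rw [if_neg ha, Finset.sum_eq_zero fun ν _ => if_neg fun h => ha h.1]
      rw [Finset.sum_congr rfl this, Finset.sum_comm]
      refine Finset.sum_congr rfl fun ν _ => ?_
      rw [Finset.sum_comm, Finset.sum_congr rfl fun i _ => sum_ite_unique (below l)
        (fun κ => AddsBox κ i l ∧ HorizontalStrip ν κ) (fun κ h => mem_below.mpr h.1.le)
        (fun κ κ' h h' => h.1.unique_left h'.1)
        (if ν.card + d + 1 = l.card then ((N : ℚ) + l.rowLen i - i) * kostka ν γ' else 0)]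
      split_ifs with hc
      · rw [Finset.sum_mul]
        exact Finset.sum_congr rfl fun i _ => by rw [ite_mul, zero_mul]
      · simp
    rw [Finset.sum_range_succ, hfirst, hlast, hright, Finset.mul_sum, ← Finset.sum_add_distrib]
    refine Finset.sum_congr rfl fun ν _ => ?_
    rw [Finsupp.add_apply, h' N le_rfl, Finsupp.single_eq_same, zero_add]
    by_cases hc : ν.card + d + 1 = l.card
    · rw [if_pos hc, if_pos hc, ← strip_identity hc hM]
      by_cases hs : HorizontalStrip ν l
      · rw [if_pos ⟨hs, by omega⟩, if_pos hs]
        ring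
      · rw [if_neg fun h => hs h.1, if_neg hs]
        ring
    · rw [if_neg hc, if_neg hc, if_neg fun h => hc (by have := h.2; omega), mul_zero, add_zero]

/-! ### The Schur functions form a basis of the symmetric functions -/

/-- The sequence of row lengths of a diagram, as an exponent vector; it is the weight of the
tableau whose entry in each box is the row index. -/
def rowWeight (l : YoungDiagram) : ℕ →₀ ℕ := weight (SemistandardYoungTableau.highestWeight l)

theorem rowWeight_eq_weight {l : YoungDiagram} (T : SemistandardYoungTableau l)
    (h : ∀ c ∈ l.cells, T c.1 c.2 = c.1) : weight T = rowWeight l := by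
  rw [rowWeight, weight, weight]
  refine Finset.sum_congr rfl fun c hc => ?_
  rw [h c hc, SemistandardYoungTableau.highestWeight_apply, if_pos (show (c.1, c.2) ∈ l from hc)]

theorem rowWeight_apply (l : YoungDiagram) (k : ℕ) : rowWeight l k = l.rowLen k := by
  rw [rowWeight, weight_apply, YoungDiagram.rowLen_eq_card, YoungDiagram.row]
  congr 1
  refine Finset.filter_congr fun c hc => ?_
  rw [SemistandardYoungTableau.highestWeight_apply, if_pos (show (c.1, c.2) ∈ l from hc)]

theorem rowWeight_injective : Function.Injective rowWeight := fun l m h =>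
  diagram_ext fun k => by rw [← rowWeight_apply, h, rowWeight_apply]

theorem le_entry {l : YoungDiagram} (T : SemistandardYoungTableau l) {i j : ℕ}
    (h : (i, j) ∈ l) : i ≤ T i j := by
  induction i with
  | zero => exact Nat.zero_le _
  | succ i ih =>
    exact (ih (l.up_left_mem (Nat.le_succ i) le_rfl h)).trans_lt
      (T.col_strict (Nat.lt_succ_self i) h)

theorem sum_entries {l : YoungDiagram} (T : SemistandardYoungTableau l) :
    Finsupp.weight id (weight T) = ∑ c ∈ l.cells, T c.1 c.2 := by
  rw [weight, map_sum]
  refine Finset.sum_congr rfl fun c _ => ?_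
  rw [Finsupp.weight_single, one_smul, id]

theorem weight_rowWeight (l : YoungDiagram) : Finsupp.weight id (rowWeight l) = rowStat l := by
  rw [rowWeight, sum_entries, rowStat]
  refine Finset.sum_congr rfl fun c hc => ?_
  rw [SemistandardYoungTableau.highestWeight_apply, if_pos (show (c.1, c.2) ∈ l from hc)]

/-- Triangularity of the Kostka numbers with respect to `rowStat`: entries are at least their row
index, and the sum of the entries of a tableau is determined by its weight. -/
theorem eq_of_kostka_rowWeight_ne_zero {l m : YoungDiagram} (h : kostka l (rowWeight m) ≠ 0)
    (hle : rowStat m ≤ rowStat l) : l = m := by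
  obtain ⟨⟨T, hT⟩⟩ := (Nat.card_ne_zero.mp h).1
  have hsum : ∑ c ∈ l.cells, T c.1 c.2 = rowStat m := by
    rw [← sum_entries, hT, weight_rowWeight]
  have hentry : ∀ c ∈ l.cells, c.1 ≤ T c.1 c.2 := fun c hc => le_entry T hc
  have heq : rowStat l = ∑ c ∈ l.cells, T c.1 c.2 :=
    le_antisymm (Finset.sum_le_sum hentry) (hsum.trans_le hle)
  have := (Finset.sum_eq_sum_iff_of_le hentry).mp heq
  exact rowWeight_injective ((rowWeight_eq_weight T fun c hc => (this c hc).symm).symm.trans hT)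

theorem kostka_rowWeight_self_ne_zero (l : YoungDiagram) : kostka l (rowWeight l) ≠ 0 :=
  Nat.card_ne_zero.mpr ⟨⟨⟨SemistandardYoungTableau.highestWeight l, rfl⟩⟩, finite_tableaux _ _⟩

/-- The linear map sending a diagram to its Schur function. -/
def toSeries : DiagSpan →ₗ[ℚ] MvPowerSeries ℕ ℚ := Finsupp.linearCombination ℚ schur

theorem toSeries_diag (l : YoungDiagram) : toSeries (diag l) = schur l := by
  rw [toSeries, diag, Finsupp.linearCombination_single, one_smul]

theorem coeff_toSeries (γ : ℕ →₀ ℕ) (x : DiagSpan) :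
    MvPowerSeries.coeff γ (toSeries x) = ∑ l ∈ x.support, x l * kostka l γ := by
  rw [toSeries, Finsupp.linearCombination_apply, Finsupp.sum, map_sum]
  refine Finset.sum_congr rfl fun l _ => ?_
  rw [map_smul, coeff_schur, smul_eq_mul]

/-- By triangularity, a combination of Schur functions vanishes if its coefficients at the diagrams
occurring in it do: a diagram with minimal `rowStat` is the only one contributing to its own
coefficient. -/
theorem eq_zero_of_coeff_rowWeight {x : DiagSpan}
    (h : ∀ m ∈ x.support, MvPowerSeries.coeff (rowWeight m) (toSeries x) = 0) : x = 0 := by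
  by_contra hne
  obtain ⟨m, hm, hmin⟩ := Finset.exists_min_image x.support rowStat
    (Finsupp.support_nonempty_iff.mpr hne)
  have h0 := h m hm
  rw [coeff_toSeries, Finset.sum_eq_single m] at h0
  · rcases mul_eq_zero.mp h0 with h1 | h1
    · exact Finsupp.mem_support_iff.mp hm h1
    · exact kostka_rowWeight_self_ne_zero m (Nat.cast_eq_zero.mp h1)
  · intro l hl hlm
    have : kostka l (rowWeight m) = 0 := by
      by_contra hk
      exact hlm (eq_of_kostka_rowWeight_ne_zero hk (hmin l hl))
    rw [this, Nat.cast_zero, mul_zero]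
  · exact fun hn => absurd hm hn

theorem toSeries_injective : Function.Injective toSeries :=
  (injective_iff_map_eq_zero _).mpr fun x hx => eq_zero_of_coeff_rowWeight fun m _ => by
    rw [hx, map_zero]

theorem toSeries_mem (x : DiagSpan) : toSeries x ∈ symmetricFunctions := by
  rw [toSeries, Finsupp.linearCombination_apply]
  exact Subalgebra.sum_mem _ fun l _ => Subalgebra.smul_mem _ (schur_mem_symmetricFunctions l) _

theorem finite_card_le (d : ℕ) : {l : YoungDiagram | l.card ≤ d}.Finite := by
  refine Set.Finite.of_injOn (f := YoungDiagram.cells)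
    (t := ((Finset.range d ×ˢ Finset.range d).powerset : Set _)) ?_ ?_ (Finset.finite_toSet _)
  · intro l hl
    have hl' : l.card ≤ d := hl
    rw [Finset.mem_coe, Finset.mem_powerset]
    rintro ⟨i, j⟩ hc
    have h1 : (Finset.range (i + 1) ×ˢ {j}).card ≤ l.card := by
      refine Finset.card_le_card ?_
      rintro ⟨a, b⟩ hab
      simp only [Finset.mem_product, Finset.mem_range, Finset.mem_singleton] at hab
      exact l.up_left_mem (by omega) (by omega) hc
    have h2 : (({i} : Finset ℕ) ×ˢ Finset.range (j + 1)).card ≤ l.card := by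
      refine Finset.card_le_card ?_
      rintro ⟨a, b⟩ hab
      simp only [Finset.mem_product, Finset.mem_range, Finset.mem_singleton] at hab
      exact l.up_left_mem (by omega) (by omega) hc
    simp only [Finset.card_product, Finset.card_range, Finset.card_singleton] at h1 h2
    simp only [Finset.mem_product, Finset.mem_range]
    omega
  · intro l _ m _ h
    exact YoungDiagram.ext h

/-- Every exponent vector can be sorted into the row lengths of a diagram. -/
theorem exists_mapDomain_eq_rowWeight (γ : ℕ →₀ ℕ) :
    ∃ (e : Equiv.Perm ℕ) (l : YoungDiagram), γ.mapDomain e = rowWeight l := by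
  obtain ⟨N, hN⟩ := exists_bound γ
  let f : Fin N → ℕᵒᵈ := fun i => OrderDual.toDual (γ i)
  have hmono := Tuple.monotone_sort f
  set σ := Tuple.sort f with hσ
  let e : Equiv.Perm ℕ := σ.extendDomain Fin.equivSubtype
  have he : ∀ k (hk : k < N), e k = σ ⟨k, hk⟩ := fun k hk =>
    Equiv.Perm.extendDomain_apply_image σ Fin.equivSubtype ⟨k, hk⟩
  have he' : ∀ k, N ≤ k → e k = k := fun k hk =>
    Equiv.Perm.extendDomain_apply_not_subtype σ Fin.equivSubtype (by omega)
  have hanti : Antitone fun k => γ (e k) := by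
    intro a b hab
    rcases Nat.lt_or_ge b N with hb | hb
    · dsimp only
      rw [he a (by omega), he b hb]
      exact hmono (show (⟨a, by omega⟩ : Fin N) ≤ ⟨b, hb⟩ from hab)
    · dsimp only
      rw [he' b hb, hN b hb]
      exact Nat.zero_le _
  obtain ⟨l, hl⟩ := exists_rowLen_eq _ hanti N (by rw [he' N le_rfl, hN N le_rfl])
  refine ⟨e.symm, l, ?_⟩
  ext k
  rw [rowWeight_apply, hl, Finsupp.mapDomain_equiv_apply, Equiv.symm_symm]

theorem coeff_mapDomain_of_mem {p : MvPowerSeries ℕ ℚ} (hp : p ∈ symmetricFunctions)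
    (e : Equiv.Perm ℕ) (γ : ℕ →₀ ℕ) :
    MvPowerSeries.coeff (γ.mapDomain e) p = MvPowerSeries.coeff γ p := by
  conv_lhs => rw [← hp.1 e]
  exact coeff_mapDomain_rename e p γ

theorem degree_rowWeight (l : YoungDiagram) : (rowWeight l).degree = l.card := degree_weight _

/-- A symmetric function is determined by its coefficients at the partitions. -/
theorem symmetricFunctions_ext {p q : MvPowerSeries ℕ ℚ} (hp : p ∈ symmetricFunctions)
    (hq : q ∈ symmetricFunctions)
    (h : ∀ l, MvPowerSeries.coeff (rowWeight l) p = MvPowerSeries.coeff (rowWeight l) q) :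
    p = q := by
  ext γ
  obtain ⟨e, l, he⟩ := exists_mapDomain_eq_rowWeight γ
  rw [← coeff_mapDomain_of_mem hp e, ← coeff_mapDomain_of_mem hq e, he, h]

/-- In bounded degree, the coefficients at the partitions can be prescribed, because the
triangular system to be solved is square and finite. -/
theorem exists_toSeries_eq {p : MvPowerSeries ℕ ℚ} (hp : p ∈ symmetricFunctions) :
    ∃ x, toSeries x = p := by
  obtain ⟨d, hd⟩ := hp.2
  set D := {l : YoungDiagram | l.card ≤ d} with hD
  have : Finite D := finite_card_le d
  let emb : (D → ℚ) →ₗ[ℚ] DiagSpan :=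
    Finsupp.lmapDomain ℚ ℚ Subtype.val ∘ₗ (Finsupp.linearEquivFunOnFinite ℚ ℚ D).symm.toLinearMap
  have hemb : Function.Injective emb :=
    (Finsupp.mapDomain_injective Subtype.val_injective).comp (LinearEquiv.injective _)
  have hsupp : ∀ c, ∀ l ∈ (emb c).support, l.card ≤ d := by
    intro c l hl
    obtain ⟨m, _, rfl⟩ := Finset.mem_image.mp (Finsupp.mapDomain_support hl)
    exact m.2
  let Ψ : (D → ℚ) →ₗ[ℚ] (D → ℚ) :=
    LinearMap.pi fun m : D => MvPowerSeries.coeff (rowWeight m.1) ∘ₗ toSeries ∘ₗ emb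
  have hΨ : Function.Injective Ψ := by
    refine (injective_iff_map_eq_zero _).mpr fun c hc => hemb ?_
    rw [map_zero]
    exact eq_zero_of_coeff_rowWeight fun m hm => congrFun hc ⟨m, hsupp c m hm⟩
  obtain ⟨c, hc⟩ := LinearMap.injective_iff_surjective.mp hΨ
    fun m => MvPowerSeries.coeff (rowWeight m.1) p
  refine ⟨emb c, symmetricFunctions_ext (toSeries_mem _) hp fun l => ?_⟩
  rcases Nat.lt_or_ge d l.card with hl | hl
  · rw [hd _ (by rwa [degree_rowWeight]), coeff_toSeries]
    refine Finset.sum_eq_zero fun m hm => ?_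
    have := hsupp c m hm
    rw [kostka_eq_zero_of_degree, Nat.cast_zero, mul_zero]
    rw [degree_rowWeight]
    omega
  · exact congrFun hc ⟨l, hl⟩

/-- The isomorphism sending a diagram to its Schur function. -/
def toSymmetric : DiagSpan ≃ₗ[ℚ] symmetricFunctions :=
  LinearEquiv.ofBijective
    (toSeries.codRestrict (Subalgebra.toSubmodule symmetricFunctions) toSeries_mem)
    ⟨fun _ _ h => toSeries_injective (congrArg Subtype.val h), fun p =>
      (exists_toSeries_eq p.2).imp fun _ h => Subtype.ext h⟩

/-! ### The Leibniz rules and the grading on symmetric functions -/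

theorem linearMap_eq_of_diag {L L' : DiagSpan →ₗ[ℚ] ℚ} (h : ∀ l, L (diag l) = L' (diag l)) :
    L = L' :=
  Finsupp.lhom_ext' fun l => LinearMap.ext_ring (h l)

theorem coeff_toSeries_boxRemoval_diag (w : ℕ × ℕ → ℚ) (l : YoungDiagram) (γ : ℕ →₀ ℕ) :
    MvPowerSeries.coeff γ (toSeries (boxRemoval w (diag l))) =
      ∑ c ∈ (removable l).attach, w c.1 * kostka (removeBox l c.1 c.2) γ := by
  rw [boxRemoval_diag, map_sum, map_sum]
  refine Finset.sum_congr rfl fun c _ => ?_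
  rw [map_smul, map_smul, toSeries_diag, coeff_schur, smul_eq_mul]

theorem coeff_pderiv_toSeries {N : ℕ} {γ : ℕ →₀ ℕ} (hγ : ∀ k, N ≤ k → γ k = 0) (x : DiagSpan) :
    MvPowerSeries.coeff γ (MvPowerSeries.pderiv ℚ N (toSeries x)) =
      MvPowerSeries.coeff γ (toSeries (xi x)) := by
  refine LinearMap.congr_fun (f := MvPowerSeries.coeff γ ∘ₗ
    (MvPowerSeries.pderiv ℚ N : MvPowerSeries ℕ ℚ →ₗ[ℚ] MvPowerSeries ℕ ℚ) ∘ₗ toSeries)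
    (g := MvPowerSeries.coeff γ ∘ₗ toSeries ∘ₗ xi) (linearMap_eq_of_diag fun l => ?_) x
  show MvPowerSeries.coeff γ (MvPowerSeries.pderiv ℚ N (toSeries (diag l))) =
    MvPowerSeries.coeff γ (toSeries (xi (diag l)))
  rw [toSeries_diag, MvPowerSeries.coeff_pderiv, xi, coeff_toSeries_boxRemoval_diag, coeff_schur,
    kostka_add_single_one l hγ, hγ N le_rfl]
  simp

/-- The derivation `∑_{i < N} ∂_i - N ∂_N`, which on symmetric functions has the same coefficients
as `∇` at the monomials in the first `N` variables. -/
def contentDerivation (N : ℕ) : Derivation ℚ (MvPowerSeries ℕ ℚ) (MvPowerSeries ℕ ℚ) :=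
  ∑ i ∈ Finset.range N, MvPowerSeries.pderiv ℚ i - (N : ℚ) • MvPowerSeries.pderiv ℚ N

theorem coeff_contentDerivation (N : ℕ) (γ : ℕ →₀ ℕ) (p : MvPowerSeries ℕ ℚ) :
    MvPowerSeries.coeff γ (contentDerivation N p) =
      ∑ i ∈ Finset.range N, MvPowerSeries.coeff γ (MvPowerSeries.pderiv ℚ i p) -
        N * MvPowerSeries.coeff γ (MvPowerSeries.pderiv ℚ N p) := by
  rw [contentDerivation, Derivation.sub_apply, Derivation.smul_apply, map_sub, map_smul,
    smul_eq_mul, ← map_sum]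
  congr 2
  induction N with
  | zero => rfl
  | succ N ih => rw [Finset.sum_range_succ, Finset.sum_range_succ, Derivation.add_apply, ih]

theorem coeff_contentDerivation_toSeries {N : ℕ} {γ : ℕ →₀ ℕ} (hγ : ∀ k, N ≤ k → γ k = 0)
    (x : DiagSpan) :
    MvPowerSeries.coeff γ (contentDerivation N (toSeries x)) =
      MvPowerSeries.coeff γ (toSeries (nabla x)) := by
  refine LinearMap.congr_fun (f := MvPowerSeries.coeff γ ∘ₗ
    (contentDerivation N : MvPowerSeries ℕ ℚ →ₗ[ℚ] MvPowerSeries ℕ ℚ) ∘ₗ toSeries)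
    (g := MvPowerSeries.coeff γ ∘ₗ toSeries ∘ₗ nabla) (linearMap_eq_of_diag fun l => ?_) x
  show MvPowerSeries.coeff γ (contentDerivation N (toSeries (diag l))) =
    MvPowerSeries.coeff γ (toSeries (nabla (diag l)))
  have h := sum_kostka_add_single N l hγ
  rw [coeff_contentDerivation, coeff_pderiv_toSeries hγ, xi, coeff_toSeries_boxRemoval_diag, nabla,
    coeff_toSeries_boxRemoval_diag, toSeries_diag]
  simp only [MvPowerSeries.coeff_pderiv, coeff_schur, one_mul, add_mul, Finset.sum_add_distrib,
    ← Finset.mul_sum] at h ⊢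
  rw [sub_eq_iff_eq_add', ← h, ← Finset.sum_add_distrib]
  exact Finset.sum_congr rfl fun i _ => by ring

/-- If derivations of power series agree with a linear operator on diagrams, at exponents in the
first `N` variables for every `N`, then this operator satisfies the Leibniz rule for the product
of power series. -/
theorem toSeries_leibniz (A : DiagSpan →ₗ[ℚ] DiagSpan)
    (D : ℕ → Derivation ℚ (MvPowerSeries ℕ ℚ) (MvPowerSeries ℕ ℚ))
    (h : ∀ N γ, (∀ k, N ≤ k → γ k = 0) → ∀ x, MvPowerSeries.coeff γ (D N (toSeries x)) =
      MvPowerSeries.coeff γ (toSeries (A x))) {x y z : DiagSpan}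
    (hz : toSeries z = toSeries x * toSeries y) :
    toSeries (A z) = toSeries (A x) * toSeries y + toSeries x * toSeries (A y) := by
  ext γ
  obtain ⟨N, hN⟩ := exists_bound γ
  have hsub : ∀ q ∈ Finset.HasAntidiagonal.antidiagonal γ,
      (∀ k, N ≤ k → q.1 k = 0) ∧ ∀ k, N ≤ k → q.2 k = 0 := by
    intro q hq
    have e := Finset.HasAntidiagonal.mem_antidiagonal.mp hq
    have e' : ∀ k, N ≤ k → q.1 k + q.2 k = 0 := fun k hk => by
      rw [← Finsupp.add_apply, e, hN k hk]
    exact ⟨fun k hk => by have := e' k hk; omega, fun k hk => by have := e' k hk; omega⟩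
  rw [← h N γ hN, hz, Derivation.leibniz, smul_eq_mul, smul_eq_mul, map_add, map_add, add_comm,
    mul_comm (toSeries y)]
  simp only [MvPowerSeries.coeff_mul]
  congr 1
  · exact Finset.sum_congr rfl fun q hq => by rw [h N _ (hsub q hq).1]
  · exact Finset.sum_congr rfl fun q hq => by rw [h N _ (hsub q hq).2]

theorem coeff_toSeries_eq_zero {x : DiagSpan} {γ : ℕ →₀ ℕ}
    (h : ∀ l ∈ x.support, l.card ≠ γ.degree) : MvPowerSeries.coeff γ (toSeries x) = 0 := by
  rw [coeff_toSeries]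
  refine Finset.sum_eq_zero fun l hl => ?_
  rw [kostka_eq_zero_of_degree (h l hl).symm, Nat.cast_zero, mul_zero]

theorem mem_homogeneous_iff {n : ℕ} {x : DiagSpan} :
    x ∈ homogeneous n ↔
      ∀ γ : ℕ →₀ ℕ, γ.degree ≠ n → MvPowerSeries.coeff γ (toSeries x) = 0 := by
  constructor
  · intro hx γ hγ
    refine coeff_toSeries_eq_zero fun l hl => ?_
    have : l.card = n := (Finsupp.mem_supported _ _).mp hx hl
    omega
  · intro h
    refine (Finsupp.mem_supported _ _).mpr fun l hl => ?_
    set z := x.filter fun l => l.card ≠ n with hz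
    set y := x.filter fun l => l.card = n with hy
    have hxyz : y + z = x := Finsupp.filter_add_filter_not x _
    have hz0 : z = 0 := by
      refine eq_zero_of_coeff_rowWeight fun m hm => ?_
      have hmn : m.card ≠ n := by
        have := Finsupp.support_filter (fun l : YoungDiagram => l.card ≠ n) x ▸ hm
        exact (Finset.mem_filter.mp this).2
      have h1 := h (rowWeight m) (by rwa [degree_rowWeight])
      rw [← hxyz, map_add, map_add, coeff_toSeries_eq_zero (x := y), zero_add] at h1
      · exact h1
      · intro l' hl'
        have := Finsupp.support_filter (fun l : YoungDiagram => l.card = n) x ▸ hl'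
        rw [degree_rowWeight, (Finset.mem_filter.mp this).2]
        exact hmn.symm
    by_contra hn
    have h2 : z l = x l := Finsupp.filter_apply_pos _ _ hn
    rw [hz0] at h2
    exact Finsupp.mem_support_iff.mp hl h2.symm

/-! ### The multiplication of diagrams -/

/-- The multiplication of diagrams: the product of symmetric functions, transported along the
isomorphism given by the Schur functions. -/
def mulDiag (x y : DiagSpan) : DiagSpan := toSymmetric.symm (toSymmetric x * toSymmetric y)

theorem toSymmetric_mulDiag (x y : DiagSpan) :
    toSymmetric (mulDiag x y) = toSymmetric x * toSymmetric y :=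
  LinearEquiv.apply_symm_apply _ _

theorem toSeries_mulDiag (x y : DiagSpan) :
    toSeries (mulDiag x y) = toSeries x * toSeries y :=
  congrArg Subtype.val (toSymmetric_mulDiag x y)

theorem toSeries_const (a : ℚ) : toSeries (const a) = MvPowerSeries.C a := by
  rw [toSeries, const, Finsupp.linearCombination_single, schur_bot,
    MvPowerSeries.smul_eq_C_mul, mul_one]

theorem isMultiplicationMap_mulDiag : IsMultiplicationMap mulDiag where
  add_left x y z := toSeries_injective (by simp only [map_add, toSeries_mulDiag, add_mul])
  add_right x y z := toSeries_injective (by simp only [map_add, toSeries_mulDiag, mul_add])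
  degree n m x y hx hy := by
    rw [mem_homogeneous_iff] at hx hy ⊢
    intro γ hγ
    rw [toSeries_mulDiag, MvPowerSeries.coeff_mul]
    refine Finset.sum_eq_zero fun q hq => ?_
    have e : q.1.degree + q.2.degree = γ.degree := by
      rw [← map_add, Finset.HasAntidiagonal.mem_antidiagonal.mp hq]
    by_cases h1 : q.1.degree = n
    · rw [hy q.2 (by omega), mul_zero]
    · rw [hx q.1 h1, zero_mul]
  constants a b := toSeries_injective (by
    rw [toSeries_mulDiag, toSeries_const, toSeries_const, toSeries_const, map_mul])
  leibniz_xi x y := toSeries_injective (by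
    rw [map_add, toSeries_mulDiag, toSeries_mulDiag]
    exact toSeries_leibniz xi (fun N => MvPowerSeries.pderiv ℚ N)
      (fun N γ hγ => coeff_pderiv_toSeries hγ) (toSeries_mulDiag x y))
  leibniz_nabla x y := toSeries_injective (by
    rw [map_add, toSeries_mulDiag, toSeries_mulDiag]
    exact toSeries_leibniz nabla contentDerivation
      (fun N γ hγ => coeff_contentDerivation_toSeries hγ) (toSeries_mulDiag x y))

theorem toSeries_mulDiag_diag (l m : YoungDiagram) :
    Finsupp.linearCombination ℚ schur (mulDiag (diag l) (diag m)) = schur l * schur m := by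
  rw [← toSeries_diag l, ← toSeries_diag m]
  exact toSeries_mulDiag _ _

theorem existsUnique_expansion (l m : YoungDiagram) : ∃! c : YoungDiagram →₀ ℚ,
    Finsupp.linearCombination ℚ schur c = schur l * schur m :=
  ⟨_, toSeries_mulDiag_diag l m, fun _ hc =>
    toSeries_injective (hc.trans (toSeries_mulDiag_diag l m).symm)⟩

theorem mulDiag_diag_apply (l m n : YoungDiagram) :
    mulDiag (diag l) (diag m) n = littlewoodRichardson l m n := by
  have h := existsUnique_expansion l m
  rw [littlewoodRichardson, dif_pos h]
  exact DFunLike.congr_fun (h.unique (toSeries_mulDiag_diag l m) h.choose_spec.1) n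

end YoungRing
end

theorem mainTheorem1 :
    ∃ f : YoungRing.DiagSpan → YoungRing.DiagSpan → YoungRing.DiagSpan,
      -- `f` is a multiplication map, and the only one
      YoungRing.IsMultiplicationMap f ∧
      (∀ g, YoungRing.IsMultiplicationMap g → g = f) ∧
      -- it is commutative and associative, with the empty diagram as unit
      (∀ x y, f x y = f y x) ∧
      (∀ x y z, f (f x y) z = f x (f y z)) ∧
      (∀ x, f (YoungRing.const 1) x = x) ∧
      -- its structure constants are the Littlewood-Richardson coefficients, which are
      -- genuinely the expansion coefficients of the products of Schur functions
      (∀ l m n : YoungDiagram,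
        f (YoungRing.diag l) (YoungRing.diag m) n = YoungRing.littlewoodRichardson l m n) ∧
      (∀ l m : YoungDiagram, ∃! c : YoungDiagram →₀ ℚ,
        Finsupp.linearCombination ℚ YoungRing.schur c =
          YoungRing.schur l * YoungRing.schur m) ∧
      -- the resulting ring is isomorphic to the ring of symmetric functions
      ∃ φ : YoungRing.DiagSpan ≃ₗ[ℚ] YoungRing.symmetricFunctions,
        φ (YoungRing.const 1) = 1 ∧
        (∀ x y, φ (f x y) = φ x * φ y) ∧
        ∀ l : YoungDiagram,
          (φ (YoungRing.diag l) : MvPowerSeries ℕ ℚ) = YoungRing.schur l := by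
  refine ⟨YoungRing.mulDiag, YoungRing.isMultiplicationMap_mulDiag,
    fun g hg => hg.unique YoungRing.isMultiplicationMap_mulDiag, fun x y => ?_, fun x y z => ?_,
    fun x => ?_, YoungRing.mulDiag_diag_apply, YoungRing.existsUnique_expansion,
    YoungRing.toSymmetric, ?_, YoungRing.toSymmetric_mulDiag, YoungRing.toSeries_diag⟩
  · exact YoungRing.toSeries_injective (by
      rw [YoungRing.toSeries_mulDiag, YoungRing.toSeries_mulDiag, mul_comm])
  · exact YoungRing.toSeries_injective (by simp only [YoungRing.toSeries_mulDiag, mul_assoc])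
  · exact YoungRing.toSeries_injective (by
      rw [YoungRing.toSeries_mulDiag, YoungRing.toSeries_const, map_one, one_mul])
  · exact Subtype.ext ((YoungRing.toSeries_const 1).trans (map_one _))
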